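/- **Setting.** Let $(K,N,\{F_l\}_{0\le l<N})$, $N\ge 3$, be a post-critically finite self-similar structure: $K$ is a connected compact metric space, the $F_l:K\to K$ are injective contractions with $K=\bigcup_l F_lK$, and there is a set $V_0=\{q_0,q_1,q_2\}$ of three boundary points with $F_lq_l=q_l$ for $l=0,1,2$, such that $F_wK\cap F_{w'}K\subset F_wV_0\cap F_{w'}V_0$ for distinct words $w,w'$ of the same length, and $q_l$ belongs to no $1$-cell other than $F_lK$. Put $V_m=\bigcup_{|w|=m}F_wV_0$, $V_*=\bigcup_m V_m$. Assume there is a regular harmonic structure with all level-$0$ conductances equal to $1$: numbers $0<r_l<1$ such that, with $E_0(u)=\sum_{0\le i<k\le 2}(u(q_i)-u(q_k))^2$ and $E_m(f)=\sum_{|w|=m}r_w^{-1}E_0(f\circ F_w|_{V_0})$, the minimum of $E_1$ over all extensions of $u$ from $V_0$ to $V_1$ is $E_0(u)$. A continuous function is harmonic if for each $m$ it minimizes $E_{m+1}$ among functions with the same values on $V_m$. Let $\mu$ be the self-similar probability measure with weights $\mu_l>0$, $\sum_l\mu_l=1$, and assume that $r_l\mu_l=\rho$ for all $l$. Assume $D3$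 symmetry: every permutation of $V_0$ is induced by a homeomorphism of $K$ that maps cells to cells of the same level and vertices of cells to vertices of cells, and preserves the factors $r_w$ and $\mu_w$ of cells. Assume that for $l=0,1,2$ the matrix $M_l$ of the map $h\mapsto h\circ F_l$ on harmonic functions (identified with their boundary values) is nondegenerate; its eigenvalues are $1$, $r=r_0=r_1=r_2$ and a third one, $\lambda$. For $x\in V_m\setminus V_0$ let $\tilde\Delta_mf(x)=\big(\int\psi_x^m\,d\mu\big)^{-1}\sum_{y\sim_m x}c_{xy}(f(y)-f(x))$, where $c_{xy}=r_w^{-1}$ for an edge $xy$ of the cell $F_wK$, $|w|=m$ (an edge being counted once for each $m$-cell containing it), and $\psi^m_x$ is the function that is harmonic on each $m$-cell, $1$ at $x$ and $0$ at the other points of $V_m$. Write $\Delta f=g$ if $f,g$ are continuous and $\tilde\Delta_mf\to g$ uniformly on $V_*\setminus V_0$. With cyclic notation $q_{l+3}=q_l$ put $$\partial_nf(q_l)=\lim_{m\to\infty} r^{-m}\big(2f(q_l)-f(F_l^mq_{l+1})-f(F_l^mq_{l-1})\big),$$ $$\partial_Tf(q_l)=\lim_{m\to\infty}\lambda^{-m}\big(f(F_l^mq_{l+1})-f(F_l^mq_{l-1})\big),$$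 where in $\partial_T f(q_l)$ the number $\lambda$ is the third eigenvalue of $M_l$. For $j\ge0$ let $Q^{(l)}_{j1}$ be the monomial at $q_l$: the function with $\Delta^{n+1}Q^{(l)}_{j1}=0$ for some $n\ge j$ and $\Delta^iQ^{(l)}_{j1}(q_l)=\delta_{ij}$, $\partial_n\Delta^iQ^{(l)}_{j1}(q_l)=\partial_T\Delta^iQ^{(l)}_{j1}(q_l)=0$ for $0\le i\le n$. Let $\alpha_j=Q^{(0)}_{j1}(q_1)$. **Theorem 7.2.** Let $l\in\{0,1,2\}$. Then $\alpha_j=Q_{j1}^{(l)}(q_{l+1})=Q_{j1}^{(l)}(q_{l-1})$ for all $j\ge 0$, and for every $j\ge2$: (a) the values of $Q^{(l)}_{j1}$ on $V_1$ satisfy $$\tilde\Delta_1Q^{(l)}_{j1}(x)=\sum_{i=1}^{j}\rho^{i-1}\alpha_1^{-1}\alpha_i\,Q^{(l)}_{(j-i)1}(x)\quad\text{for all } x\in V_1\setminus V_0,$$ $$Q_{j1}^{(l)}(F_lq)=\rho^jQ_{j1}^{(l)}(q)\quad\text{for all } q\in V_0;$$ (b) they are uniquely determined by the values of $Q^{(l)}_{i1}$,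 $0\le i<j$, on $V_1$ through these relations: a function $f$ on $V_1$ satisfies $f(q_{l+1})=f(q_{l-1})$ together with $$\tilde\Delta_1f(x)=\sum_{i=1}^{j-1}\rho^{i-1}\alpha_1^{-1}\alpha_i\,Q^{(l)}_{(j-i)1}(x)+\rho^{j-1}\alpha_1^{-1}f(q_{l+1})\,Q^{(l)}_{01}(x),\quad x\in V_1\setminus V_0,$$ $$f(F_lq)=\rho^jf(q),\quad q\in V_0,$$ where $\alpha_i=Q^{(l)}_{i1}(q_{l+1})$ for $i<j$, if and only if $f=Q^{(l)}_{j1}$ on $V_1$. Consequently the numbers $\alpha_j$ are computed recursively. One has $\alpha_0=1$ and $\alpha_1=\frac16$. Start with $f_0=1$ on $V_1$ and a function $f_1$ on $V_1$ with $\tilde\Delta_1f_1=1$ on $V_1\setminus V_0$, $f_1(q_l)=0$, $f_1(q_{l\pm1})=\frac16$; for $j=2,3,\dots$ let $f_j$ solve the system in (b) with $f_i$ in place of $Q_{i1}^{(l)}$ and $f_i(q_{l+1})$ in place of $\alpha_i$ for $i<j$. Then $f_j=Q^{(l)}_{j1}$ on $V_1$ and $\alpha_j=f_j(q_{l+1})$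 for all $j\ge 0$. -/

import Mathlib

open Set Filter Topology MeasureTheory

noncomputable section

/-- The map `F_w = F_{w_1} ∘ ⋯ ∘ F_{w_m}` attached to a word `w` of length `m`. -/
def wordMap {K : Type*} {N : ℕ} (F : Fin N → K → K) : (m : ℕ) → (Fin m → Fin N) → K → K
  | 0, _ => id
  | m + 1, w => F (w 0) ∘ wordMap F m (Fin.tail w)

/-- The level-0 energy on the complete graph on three vertices, with all conductances `1`. -/
def energyZero (u : Fin 3 → ℝ) : ℝ :=
  (u 0 - u 1) ^ 2 + (u 1 - u 2) ^ 2 + (u 2 - u 0) ^ 2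

/-- A post-critically finite self-similar structure on `K` with three boundary points
`q 0, q 1, q 2`, where `q i` is the fixed point of the `i`-th map. -/
structure PCFStructure (K : Type*) [MetricSpace K] (N : ℕ) where
  F : Fin N → K → K
  contracting : ∀ l, ∃ c, ContractingWith c (F l)
  injective : ∀ l, Function.Injective (F l)
  cover : ⋃ l, range (F l) = univ
  connected : ConnectedSpace K
  three_le : 3 ≤ N
  q : Fin 3 → K
  q_injective : Function.Injective q
  q_fixed : ∀ i, F (Fin.castLE three_le i) (q i) = q i
  /-- Distinct cells of the same level meet only in images of boundary points. -/
  inter_subset : ∀ (m : ℕ) (w w' : Fin m → Fin N), w ≠ w' →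
    range (wordMap F m w) ∩ range (wordMap F m w') ⊆
      (wordMap F m w '' range q) ∩ (wordMap F m w' '' range q)
  /-- The boundary point `q i` lies in no 1-cell but the `i`-th one. (This is automatic when the
  post-critical set is finite: if also `q i = F l y` with `l ≠ i`, then all the words
  `i ⋯ i l ω`, with `ω` an address of `y`, belong to the post-critical set.) -/
  boundary_cell : ∀ (i : Fin 3) (l : Fin N), q i ∈ range (F l) → l = Fin.castLE three_le i

/-- A p.c.f. structure together with a regular harmonic structure (all level-0 conductances `1`,
renormalization factors `r l`) and the probability weights `mu l` of a self-similar measure. -/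
structure HarmonicPCF (K : Type*) [MetricSpace K] (N : ℕ) extends PCFStructure K N where
  r : Fin N → ℝ
  r_pos : ∀ l, 0 < r l
  r_lt_one : ∀ l, r l < 1
  /-- The restriction to `V_0` of the level-1 energy `∑ l, r_l⁻¹ E_0(f ∘ F_l)`, i.e. its minimum
  over all extensions, is the level-0 energy. -/
  energy_restrict : ∀ u : Fin 3 → ℝ,
    IsLeast {e : ℝ | ∃ f : K → ℝ, (∀ i, f (q i) = u i) ∧
      e = ∑ l, (r l)⁻¹ * energyZero (fun i => f (F l (q i)))} (energyZero u)
  mu : Fin N → ℝ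
  mu_pos : ∀ l, 0 < mu l
  mu_sum : ∑ l, mu l = 1

namespace HarmonicPCF

variable {K : Type*} [MetricSpace K] {N : ℕ} (S : HarmonicPCF K N)

/-- `F_w`. -/
def Fw {m : ℕ} (w : Fin m → Fin N) : K → K := wordMap S.F m w

/-- `r_w = r_{w_1} ⋯ r_{w_m}`. -/
def rWord {m : ℕ} (w : Fin m → Fin N) : ℝ := ∏ k, S.r (w k)

/-- `μ_w = μ_{w_1} ⋯ μ_{w_m}`. -/
def muWord {m : ℕ} (w : Fin m → Fin N) : ℝ := ∏ k, S.mu (w k)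

/-- The index, among all `N` maps, of the map fixing the boundary point `q l`. -/
def corner (l : Fin 3) : Fin N := Fin.castLE S.three_le l

/-- The map `F_l` fixing the boundary point `q l`. -/
def FB (l : Fin 3) : K → K := S.F (S.corner l)

/-- The vertex set `V_m`; in particular `V_0 = {q 0, q 1, q 2}`. -/
def V (m : ℕ) : Set K := {x | ∃ (w : Fin m → Fin N) (i : Fin 3), S.Fw w (S.q i) = x}

/-- The renormalized graph energy `E_m(f, f) = ∑_{|w| = m} r_w⁻¹ E_0(f ∘ F_w)`. -/
def energy (m : ℕ) (f : K → ℝ) : ℝ :=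
  ∑ w : Fin m → Fin N, (S.rWord w)⁻¹ * energyZero (fun i => f (S.Fw w (S.q i)))

/-- Harmonic functions: continuous functions minimizing the energy from level `m` to level
`m + 1` for every `m`. -/
def IsHarmonic (h : K → ℝ) : Prop :=
  Continuous h ∧ ∀ (m : ℕ) (f : K → ℝ), (∀ x ∈ S.V m, f x = h x) →
    S.energy (m + 1) h ≤ S.energy (m + 1) f

/-- The harmonic function with prescribed boundary values. -/
def harmonicExt (u : Fin 3 → ℝ) : K → ℝ :=
  Classical.epsilon fun h => S.IsHarmonic h ∧ ∀ i, h (S.q i) = u i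

/-- The `l`-th harmonic extension matrix: the matrix of `h ↦ h ∘ F_l` on harmonic functions,
these being identified with their boundary values. -/
def M (l : Fin 3) : Matrix (Fin 3) (Fin 3) ℝ :=
  Matrix.of fun i k => S.harmonicExt (Pi.single k 1) (S.FB l (S.q i))

/-- The third eigenvalue `λ` of `M_l`: what remains of the multiset of its eigenvalues after
removing the eigenvalues `1` and `r`. -/
def lam (l : Fin 3) : ℝ :=
  (((S.M l).charpoly.roots.erase 1).erase (S.r (S.corner l))).sum

/-- `ψ` is the tent function `ψ_x^m`: harmonic on each `m`-cell, `1` at `x` and `0` at the other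
vertices of level `m`. -/
def IsTent (m : ℕ) (x : K) (ψ : K → ℝ) : Prop :=
  (∀ w : Fin m → Fin N, S.IsHarmonic (ψ ∘ S.Fw w)) ∧ ψ x = 1 ∧ ∀ y ∈ S.V m, y ≠ x → ψ y = 0

/-- The tent function `ψ_x^m`. -/
def tent (m : ℕ) (x : K) : K → ℝ := Classical.epsilon fun ψ => S.IsTent m x ψ

open Classical in
/-- The graph Laplacian `Δ_m f(x) = ∑_{y ∼_m x} c_{xy} (f y - f x)`. The sum runs over the edges
from `x = F_w q_i` to `F_w q_k`, in all `m`-cells with vertex `x`; such an edge has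
conductance `r_w⁻¹`. -/
def graphLaplacian (m : ℕ) (f : K → ℝ) (x : K) : ℝ :=
  ∑ w : Fin m → Fin N, ∑ i : Fin 3, ∑ k : Fin 3,
    if S.Fw w (S.q i) = x then (S.rWord w)⁻¹ * (f (S.Fw w (S.q k)) - f x) else 0

/-- A homeomorphism of `K` that leaves the structure invariant: it maps cells of level `m` to
cells of level `m`, vertices of cells to vertices of cells, and preserves the renormalization
factors and the measures of the cells. -/
def IsSymmetry (g : K ≃ₜ K) : Prop :=
  ∀ (m : ℕ) (w : Fin m → Fin N), ∃ w' : Fin m → Fin N,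
    g '' range (S.Fw w) = range (S.Fw w') ∧
    g '' (S.Fw w '' range S.q) = S.Fw w' '' range S.q ∧
    S.rWord w' = S.rWord w ∧ S.muWord w' = S.muWord w

/-- `D3` symmetry: every permutation of the three boundary points is realized by a homeomorphism
of `K` that leaves the structure invariant. -/
def IsD3Symmetric : Prop :=
  ∀ σ : Equiv.Perm (Fin 3), ∃ g : K ≃ₜ K, (∀ i, g (S.q i) = S.q (σ i)) ∧ S.IsSymmetry g

/-- `∂_n f(q_l) = d`, in particular the defining limit exists. -/
def HasNormalDeriv (f : K → ℝ) (l : Fin 3) (d : ℝ) : Prop :=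
  Tendsto (fun m : ℕ => (S.r (S.corner l) ^ m)⁻¹ *
    (2 * f (S.q l) - f ((S.FB l)^[m] (S.q (l + 1))) - f ((S.FB l)^[m] (S.q (l - 1)))))
    atTop (𝓝 d)

/-- `∂_T f(q_l) = d`, in particular the defining limit exists. -/
def HasTransverseDeriv (f : K → ℝ) (l : Fin 3) (d : ℝ) : Prop :=
  Tendsto (fun m : ℕ => (S.lam l ^ m)⁻¹ *
    (f ((S.FB l)^[m] (S.q (l + 1))) - f ((S.FB l)^[m] (S.q (l - 1)))))
    atTop (𝓝 d)

variable [MeasurableSpace K] (ν : Measure K)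

/-- `ν` is the self-similar probability measure with weights `mu l`. -/
def IsSelfSimilarMeasure : Prop :=
  IsProbabilityMeasure ν ∧ ∀ A : Set K, MeasurableSet A →
    ν A = ∑ l, ENNReal.ofReal (S.mu l) * ν (S.F l ⁻¹' A)

/-- The renormalized graph Laplacian `(∫ ψ_x^m dν)⁻¹ Δ_m f(x)`. -/
def renLaplacian (m : ℕ) (f : K → ℝ) (x : K) : ℝ :=
  (∫ y, S.tent m x y ∂ν)⁻¹ * S.graphLaplacian m f x

/-- `f ∈ dom Δ` and `Δ f = g`: both functions are continuous, and the renormalized graph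
Laplacians of `f` converge to `g` uniformly on `V_* \ V_0`. -/
def HasLaplacian (f g : K → ℝ) : Prop :=
  Continuous f ∧ Continuous g ∧ ∀ ε > 0, ∃ m₀ : ℕ, ∀ m ≥ m₀, ∀ x ∈ S.V m \ S.V 0,
    |S.renLaplacian ν m f x - g x| < ε

/-- `Δ^i f = g`. -/
def HasIterLaplacian : ℕ → (K → ℝ) → (K → ℝ) → Prop
  | 0, f, g => Continuous f ∧ g = f
  | i + 1, f, g => ∃ h, HasIterLaplacian i f h ∧ S.HasLaplacian ν h g

/-- The space `H_n` of `(n+1)`-harmonic functions. -/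
def IsMultiharmonic (n : ℕ) (f : K → ℝ) : Prop := S.HasIterLaplacian ν (n + 1) f 0

/-- `f` is the monomial `Q_{jk}^{(l)}`, `k = 1, 2, 3`. -/
def IsMonomial (l : Fin 3) (j k : ℕ) (f : K → ℝ) : Prop :=
  ∃ n, j ≤ n ∧ S.IsMultiharmonic ν n f ∧ ∀ i ≤ n, ∃ g, S.HasIterLaplacian ν i f g ∧
    g (S.q l) = (if i = j ∧ k = 1 then 1 else 0) ∧
    S.HasNormalDeriv g l (if i = j ∧ k = 2 then 1 else 0) ∧
    S.HasTransverseDeriv g l (if i = j ∧ k = 3 then 1 else 0)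

/-- The determining system at stage `j ≥ 2`, with unknown `f` (only its values on `V_1` enter) and
with the values on `V_1` of the functions `P i`, `i < j`, as data. The coefficients are
`P i (q_{l+1})` for `i < j`, while the `j`-th one is the unknown common value of `f` at the two
boundary points other than `q_l`. -/
def IsRecursionSolution (ρ : ℝ) (l : Fin 3) (j : ℕ) (P : ℕ → K → ℝ) (f : K → ℝ) : Prop :=
  (∀ x ∈ S.V 1 \ S.V 0, S.renLaplacian ν 1 f x =
    (∑ i ∈ Finset.Ico 1 j,
      ρ ^ (i - 1) * (P 1 (S.q (l + 1)))⁻¹ * P i (S.q (l + 1)) * P (j - i) x) +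
    ρ ^ (j - 1) * (P 1 (S.q (l + 1)))⁻¹ * f (S.q (l + 1)) * P 0 x) ∧
  (∀ i, f (S.FB l (S.q i)) = ρ ^ j * f (S.q i)) ∧
  f (S.q (l - 1)) = f (S.q (l + 1))

end HarmonicPCF

end

/-! Everything rests on a uniqueness principle: a multiharmonic function all of whose iterated
Laplacians have value, normal and transverse derivative 0 at q_l vanishes (`IsJet.eq_zero`), because
for invertible M_l a harmonic function is determined by these three numbers. Comparing jets gives
the scaling Q_j ∘ F_l = ρ^j Q_j (`monomial_FB`) and the invariance of the monomials under D3
(`monomial_comp_symmetry`), hence the equality of their boundary values.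

The relation at a junction point x of V_1 comes from folding. For every 1-cell F_a K with x = F_a
q_k, pull Q_j back by F_a and by a symmetry taking q_l to q_k, and add the results with weights
r_a⁻¹ (`localSum`). At q_l the i-th Laplacian of the sum has value ρ^i W Q_{j-i}(x), where W is the
sum of the weights. Its normal derivative is 0, since normal derivatives of a function in the domain
of Δ cancel at x; adding the reflected sum kills the transverse derivatives. So the symmetrized sum
equals ∑ 2ρ^i W Q_{j-i}(x) Q_i, and the level-0 Laplacian at q_l expresses Δ_1 Q_j(x) through the
α_i (`graphLaplacian_one_monomial`). By D3 symmetry a tent function has as integral one third of the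
measure of its cells (`integral_tent`), which turns 2ρ^i W into 6ρ^{i-1}; and α_1 = 1/6 because the
renormalized Laplacians of Q_1 converge to 1.

For unique solvability, the difference d of two solutions has renormalized Laplacian 6ρ^{j-1}c on
V_1 \ V_0, with c = d(q_{l+1}), and the scaling relation extends this to q_l. Green's formula
against the harmonic function with boundary value 1 at q_l and 0 at the other two points gives c =
ρ^{j-1}c, so c = 0 for j ≥ 2 (`eqOn_zero_of_homogeneous_system`). -/

/-! ### Gluing, indices modulo 3, words. -/

theorem exists_glue {X ι : Type*} [TopologicalSpace X] [CompactSpace X] [T2Space X] [Finite ι]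
    (φ : ι → X → X) (hφ : ∀ i, Continuous (φ i)) (hcov : ∀ x, ∃ i y, φ i y = x) (g : ι → X → ℝ)
    (hg : ∀ i j x y, φ i x = φ j y → g i x = g j y) :
    ∃ f : X → ℝ, (∀ i x, f (φ i x) = g i x) ∧ ((∀ i, Continuous (g i)) → Continuous f) := by
  choose a b hab using hcov
  have key : ∀ i x, g (a (φ i x)) (b (φ i x)) = g i x := fun i x => hg _ _ _ _ (hab _)
  refine ⟨fun x => g (a x) (b x), key, fun hc => continuous_iff_isClosed.2 fun C hC => ?_⟩
  have : (fun x => g (a x) (b x)) ⁻¹' C = ⋃ i, φ i '' (g i ⁻¹' C) := by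
    ext x
    simp only [mem_preimage, mem_iUnion, mem_image]
    constructor
    · intro h
      exact ⟨a x, b x, h, hab x⟩
    · rintro ⟨i, y, hy, rfl⟩
      rwa [key]
  rw [this]
  exact isClosed_iUnion_of_finite fun i =>
    ((hC.preimage (hc i)).isCompact.image (hφ i)).isClosed

theorem Fin.add_one_ne_self_three (l : Fin 3) : l + 1 ≠ l := by fin_cases l <;> decide

theorem Fin.sub_one_ne_self_three (l : Fin 3) : l - 1 ≠ l := by fin_cases l <;> decide

theorem Fin.add_one_ne_sub_one_three (l : Fin 3) : l + 1 ≠ l - 1 := by fin_cases l <;> decide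

theorem Fin.eq_or_three (l i : Fin 3) : i = l ∨ i = l + 1 ∨ i = l - 1 := by
  fin_cases l <;> fin_cases i <;> decide

theorem Fin.sum_univ_three_cyclic (u : Fin 3 → ℝ) (l : Fin 3) :
    ∑ i, u i = u l + u (l + 1) + u (l - 1) := by
  rw [Fin.sum_univ_three]
  fin_cases l
  · rfl
  · show _ = u 1 + u 2 + u 0
    ring
  · show _ = u 2 + u 0 + u 1
    ring

theorem sum_words_succ {N m : ℕ} {M : Type*} [AddCommMonoid M] (φ : (Fin (m + 1) → Fin N) → M) :
    ∑ w, φ w = ∑ l, ∑ w : Fin m → Fin N, φ (Fin.cons l w) := by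
  rw [← Fintype.sum_prod_type']
  exact (Fintype.sum_equiv (Fin.consEquiv fun _ => Fin N) _ _ fun _ => rfl).symm

/-! ### Combinatorics of cells and vertices. -/

namespace HarmonicPCF

variable {K : Type*} [MetricSpace K] {N : ℕ} (S : HarmonicPCF K N)

theorem F_continuous (l : Fin N) : Continuous (S.F l) := by
  obtain ⟨c, hc⟩ := S.contracting l
  exact hc.toLipschitzWith.continuous

theorem Fw_cons {m : ℕ} (l : Fin N) (w : Fin m → Fin N) (x : K) :
    S.Fw (Fin.cons l w) x = S.F l (S.Fw w x) := by
  simp [Fw, wordMap]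

theorem Fw_zero (w : Fin 0 → Fin N) (x : K) : S.Fw w x = x := rfl

theorem Fw_one (w : Fin 1 → Fin N) (x : K) : S.Fw w x = S.F (w 0) x := rfl

theorem Fw_succ {m : ℕ} (w : Fin (m + 1) → Fin N) (x : K) :
    S.Fw w x = S.F (w 0) (S.Fw (Fin.tail w) x) := rfl

theorem Fw_injective : ∀ {m : ℕ} (w : Fin m → Fin N), Function.Injective (S.Fw w)
  | 0, _ => Function.injective_id
  | _ + 1, w => (S.injective (w 0)).comp (Fw_injective (Fin.tail w))

theorem Fw_continuous : ∀ {m : ℕ} (w : Fin m → Fin N), Continuous (S.Fw w)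
  | 0, _ => continuous_id
  | _ + 1, w => (S.F_continuous (w 0)).comp (Fw_continuous (Fin.tail w))

theorem F_cover (x : K) : ∃ l y, S.F l y = x := by
  have := S.cover ▸ mem_univ x
  simpa using this

theorem Fw_cover : ∀ (m : ℕ) (x : K), ∃ (w : Fin m → Fin N) (y : K), S.Fw w y = x
  | 0, x => ⟨Fin.elim0, x, rfl⟩
  | m + 1, x => by
    obtain ⟨l, y, rfl⟩ := S.F_cover x
    obtain ⟨w, z, rfl⟩ := Fw_cover m y
    exact ⟨Fin.cons l w, z, S.Fw_cons l w z⟩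

theorem Fw_inter {m : ℕ} {w w' : Fin m → Fin N} (hw : w ≠ w') {x y : K}
    (h : S.Fw w x = S.Fw w' y) : ∃ i k, x = S.q i ∧ y = S.q k := by
  obtain ⟨⟨_, ⟨i, rfl⟩, hi⟩, ⟨_, ⟨k, rfl⟩, hk⟩⟩ :=
    S.inter_subset m w w' hw ⟨⟨x, rfl⟩, ⟨y, h.symm⟩⟩
  refine ⟨i, k, (S.Fw_injective w hi).symm, (S.Fw_injective w' ?_).symm⟩
  exact hk.trans h

theorem F_inter {l l' : Fin N} (hl : l ≠ l') {x y : K}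
    (h : S.F l x = S.F l' y) : ∃ i k, x = S.q i ∧ y = S.q k :=
  S.Fw_inter (m := 1) (w := fun _ => l) (w' := fun _ => l') (fun e => hl (congrFun e 0)) h

theorem FB_q (l : Fin 3) : S.FB l (S.q l) = S.q l := S.q_fixed l

theorem q_eq_F {i : Fin 3} {l : Fin N} {x : K} (h : S.F l x = S.q i) :
    l = S.corner i ∧ x = S.q i := by
  have hl : l = S.corner i := S.boundary_cell i l ⟨x, h⟩
  refine ⟨hl, S.injective l ?_⟩
  subst hl
  exact h.trans (S.FB_q i).symm

theorem corner_injective : Function.Injective S.corner := Fin.castLE_injective S.three_le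

theorem Fw_corner (l : Fin 3) (x : K) :
    ∀ m : ℕ, S.Fw (fun _ : Fin m => S.corner l) x = (S.FB l)^[m] x
  | 0 => rfl
  | m + 1 => by
    rw [Function.iterate_succ_apply', ← Fw_corner l x m]
    rfl

theorem FB_iterate_q (l : Fin 3) (m : ℕ) : (S.FB l)^[m] (S.q l) = S.q l :=
  Function.iterate_fixed (S.FB_q l) m

/-- `boundary_cell` is applied letter by letter. Sums over the m-cells at a boundary point thereby
reduce to the single corner cell. -/
theorem Fw_eq_q {i : Fin 3} : ∀ {m : ℕ} {w : Fin m → Fin N} {x : K}, S.Fw w x = S.q i →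
    w = (fun _ => S.corner i) ∧ x = S.q i
  | 0, _, _, h => ⟨Subsingleton.elim _ _, h⟩
  | m + 1, w, x, h => by
    obtain ⟨h0, h1⟩ := S.q_eq_F ((S.Fw_succ w x).symm.trans h)
    obtain ⟨h2, h3⟩ := Fw_eq_q h1
    refine ⟨?_, h3⟩
    rw [← Fin.cons_self_tail w, h0, h2]
    ext k
    refine Fin.cases rfl (fun _ => rfl) k

theorem mem_V {m : ℕ} (w : Fin m → Fin N) (i : Fin 3) : S.Fw w (S.q i) ∈ S.V m := ⟨w, i, rfl⟩

theorem mem_V_zero {x : K} : x ∈ S.V 0 ↔ ∃ i, S.q i = x :=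
  ⟨fun ⟨_, i, h⟩ => ⟨i, h⟩, fun ⟨i, h⟩ => ⟨Fin.elim0, i, h⟩⟩

theorem q_mem_V_zero (i : Fin 3) : S.q i ∈ S.V 0 := S.mem_V_zero.2 ⟨i, rfl⟩

theorem FB_iterate_mem_V (m : ℕ) (l i : Fin 3) : (S.FB l)^[m] (S.q i) ∈ S.V m :=
  ⟨fun _ => S.corner l, i, S.Fw_corner l _ m⟩

theorem q_mem_V (m : ℕ) (i : Fin 3) : S.q i ∈ S.V m := by
  rw [← S.FB_iterate_q i m]
  exact S.FB_iterate_mem_V m i i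

theorem F_mem_V_succ {m : ℕ} (l : Fin N) {x : K} (hx : x ∈ S.V m) : S.F l x ∈ S.V (m + 1) := by
  obtain ⟨w, i, rfl⟩ := hx
  exact ⟨Fin.cons l w, i, S.Fw_cons _ _ _⟩

theorem F_notMem_V_zero (l : Fin N) {x : K} (hx : x ∉ S.V 0) : S.F l x ∉ S.V 0 := by
  rw [mem_V_zero]
  rintro ⟨i, h⟩
  exact hx (S.mem_V_zero.2 ⟨i, (S.q_eq_F h.symm).2.symm⟩)

theorem V_subset_succ : ∀ (m : ℕ), S.V m ⊆ S.V (m + 1)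
  | 0, x, hx => by
    obtain ⟨i, rfl⟩ := S.mem_V_zero.1 hx
    exact S.q_mem_V 1 i
  | m + 1, x, hx => by
    obtain ⟨w, i, rfl⟩ := hx
    rw [Fw_succ]
    exact S.F_mem_V_succ _ (V_subset_succ m (S.mem_V _ i))

/-- Functions on the cells of level `m` which agree at the common vertices can be glued. -/
theorem exists_glue_cells [CompactSpace K] {m : ℕ} (g : (Fin m → Fin N) → K → ℝ)
    (hg : ∀ w w' i k, S.Fw w (S.q i) = S.Fw w' (S.q k) → g w (S.q i) = g w' (S.q k)) :
    ∃ f : K → ℝ, (∀ w x, f (S.Fw w x) = g w x) ∧ ((∀ w, Continuous (g w)) → Continuous f) := by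
  refine exists_glue (fun w => S.Fw w) S.Fw_continuous (S.Fw_cover m) g fun w w' x y h => ?_
  by_cases hw : w = w'
  · subst hw
    rw [S.Fw_injective w h]
  · obtain ⟨i, k, rfl, rfl⟩ := S.Fw_inter hw h
    exact hg _ _ _ _ h

theorem exists_glue_one [CompactSpace K] (g : Fin N → K → ℝ)
    (hg : ∀ l l' i k, S.F l (S.q i) = S.F l' (S.q k) → g l (S.q i) = g l' (S.q k)) :
    ∃ f : K → ℝ, (∀ l x, f (S.F l x) = g l x) ∧ ((∀ l, Continuous (g l)) → Continuous f) := by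
  obtain ⟨f, hf, hc⟩ := S.exists_glue_cells (m := 1) (fun w => g (w 0))
    fun w w' i k h => hg _ _ _ _ h
  exact ⟨f, fun l x => hf (fun _ => l) x, fun h => hc fun w => h _⟩

theorem infinite {K : Type*} [MetricSpace K] {N : ℕ} (S : HarmonicPCF K N) : Infinite K := by
  have := S.connected
  have : Nontrivial K := ⟨S.q 0, S.q 1, S.q_injective.ne (by decide)⟩
  exact infinite_univ_iff.1
    (isPreconnected_univ.infinite_of_nontrivial nontrivial_univ)

/-- Cells of different words share at most three points, whereas a cell is infinite because K is
connected with more than one point. -/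
theorem Fw_range_injective {m : ℕ} {w w' : Fin m → Fin N}
    (h : range (S.Fw w) = range (S.Fw w')) : w = w' := by
  by_contra hw
  have := S.infinite
  refine infinite_univ (α := K) ((finite_range S.q).subset fun x _ => ?_)
  obtain ⟨y, hy⟩ := h ▸ mem_range_self (f := S.Fw w) x
  obtain ⟨i, k, hi, -⟩ := S.Fw_inter hw hy.symm
  exact ⟨i, hi.symm⟩

theorem exists_contraction : ∃ c : NNReal, c < 1 ∧ ∀ l, LipschitzWith c (S.F l) := by
  choose c hc using S.contracting
  have : Nonempty (Fin N) := ⟨S.corner 0⟩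
  obtain ⟨l, hl⟩ := Finite.exists_max c
  exact ⟨c l, (hc l).1, fun k => (hc k).toLipschitzWith.weaken (hl k)⟩

theorem exists_level_dist_lt [CompactSpace K] {ε : ℝ} (hε : 0 < ε) :
    ∃ m₀, ∀ m ≥ m₀, ∀ (w : Fin m → Fin N) (x y : K), dist (S.Fw w x) (S.Fw w y) < ε := by
  obtain ⟨c, hc, hF⟩ := S.exists_contraction
  have hL : ∀ m (w : Fin m → Fin N), LipschitzWith (c ^ m) (S.Fw w) := by
    intro m
    induction m with
    | zero => intro w; rw [pow_zero]; exact LipschitzWith.id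
    | succ m ih =>
      intro w
      rw [pow_succ']
      exact (hF (w 0)).comp (ih (Fin.tail w))
  set D := Metric.diam (univ : Set K)
  have hD : ∀ x y : K, dist x y ≤ D := fun x y =>
    Metric.dist_le_diam_of_mem isCompact_univ.isBounded (mem_univ x) (mem_univ y)
  have ht : Tendsto (fun m : ℕ => (c : ℝ) ^ m * D) atTop (𝓝 (0 * D)) :=
    (tendsto_pow_atTop_nhds_zero_of_lt_one c.2 (by exact_mod_cast hc)).mul_const D
  rw [zero_mul] at ht
  obtain ⟨m₀, h⟩ := eventually_atTop.1 (ht.eventually_lt_const hε)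
  refine ⟨m₀, fun m hm w x y => lt_of_le_of_lt ?_ (h m hm)⟩
  refine ((hL m w).dist_le_mul x y).trans ?_
  push_cast
  exact mul_le_mul_of_nonneg_left (hD x y) (by positivity)

theorem exists_mem_V_one : ∃ x, x ∈ S.V 1 \ S.V 0 := by
  refine ⟨S.FB 0 (S.q 1), S.FB_iterate_mem_V 1 0 1, ?_⟩
  rw [mem_V_zero]
  rintro ⟨i, hi⟩
  obtain ⟨h1, h2⟩ := S.q_eq_F hi.symm
  rw [← S.corner_injective h1] at h2
  exact absurd (S.q_injective h2) (by decide)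

theorem Fw_notMem_V_zero {m : ℕ} (w : Fin m → Fin N) {x : K} (hx : x ∉ S.V 0) :
    S.Fw w x ∉ S.V 0 := by
  rw [mem_V_zero]
  rintro ⟨i, h⟩
  exact hx (S.mem_V_zero.2 ⟨i, (S.Fw_eq_q h.symm).2.symm⟩)

theorem Fw_mem_V {n : ℕ} {x : K} (hx : x ∈ S.V n) :
    ∀ {m : ℕ} (w : Fin m → Fin N), S.Fw w x ∈ S.V (n + m)
  | 0, _ => hx
  | _ + 1, w => S.F_mem_V_succ (w 0) (Fw_mem_V hx (Fin.tail w))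

/-- V_* \ V_0 is dense: every cell, however small, contains a copy of a point of V_1 \ V_0. -/
theorem eq_of_eqOn_V [CompactSpace K] {f g : K → ℝ} (hf : Continuous f) (hg : Continuous g)
    (h : ∀ m, ∀ x ∈ S.V m \ S.V 0, f x = g x) : f = g := by
  obtain ⟨x₁, hx₁, hx₁'⟩ := S.exists_mem_V_one
  have hd : Dense {x : K | f x = g x} := by
    refine Metric.dense_iff.2 fun x ε hε => ?_
    obtain ⟨m, hm⟩ := S.exists_level_dist_lt hε
    obtain ⟨w, y, rfl⟩ := S.Fw_cover m x
    exact ⟨S.Fw w x₁, hm m le_rfl w _ _,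
      h _ _ ⟨S.Fw_mem_V hx₁ w, S.Fw_notMem_V_zero w hx₁'⟩⟩
  have hcl : IsClosed {x : K | f x = g x} := isClosed_eq hf hg
  funext x
  have : x ∈ {x : K | f x = g x} := by
    rw [← hcl.closure_eq, hd.closure_eq]
    trivial
  exact this

end HarmonicPCF

/-! ### Graph energies and the Euler–Lagrange form of harmonicity. -/

noncomputable section

/-- The polarization of `energyZero`. -/
def form0 (a b : Fin 3 → ℝ) : ℝ :=
  (a 0 - a 1) * (b 0 - b 1) + (a 1 - a 2) * (b 1 - b 2) + (a 2 - a 0) * (b 2 - b 0)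

theorem energyZero_eq_form0 (u : Fin 3 → ℝ) : energyZero u = form0 u u := by
  simp only [energyZero, form0]
  ring

theorem form0_self_nonneg (u : Fin 3 → ℝ) : 0 ≤ form0 u u := by
  rw [← energyZero_eq_form0]
  unfold energyZero
  positivity

theorem form0_comm (a b : Fin 3 → ℝ) : form0 a b = form0 b a := by
  simp only [form0]
  ring

theorem sq_sub_le_form0 (u : Fin 3 → ℝ) (i k : Fin 3) : (u i - u k) ^ 2 ≤ form0 u u := by
  rw [← energyZero_eq_form0]
  unfold energyZero
  have h1 := sq_nonneg (u 0 - u 1)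
  have h2 := sq_nonneg (u 1 - u 2)
  have h3 := sq_nonneg (u 2 - u 0)
  fin_cases i <;> fin_cases k <;> simp <;> nlinarith

namespace HarmonicPCF

variable {K : Type*} [MetricSpace K] {N : ℕ} (S : HarmonicPCF K N)

theorem rWord_cons {m : ℕ} (l : Fin N) (w : Fin m → Fin N) :
    S.rWord (Fin.cons l w) = S.r l * S.rWord w := by
  simp [rWord, Fin.prod_univ_succ]

theorem rWord_pos {m : ℕ} (w : Fin m → Fin N) : 0 < S.rWord w :=
  Finset.prod_pos fun _ _ => S.r_pos _

/-- The polarization of the energy of level `m`. -/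
def form (m : ℕ) (f v : K → ℝ) : ℝ :=
  ∑ w : Fin m → Fin N, (S.rWord w)⁻¹ *
    form0 (fun i => f (S.Fw w (S.q i))) (fun i => v (S.Fw w (S.q i)))

theorem energy_eq_form (m : ℕ) (f : K → ℝ) : S.energy m f = S.form m f f := by
  simp only [energy, form, energyZero_eq_form0]

theorem form_zero (f v : K → ℝ) :
    S.form 0 f v = form0 (fun i => f (S.q i)) (fun i => v (S.q i)) := by
  simp [form, rWord, Fw_zero]

theorem form_succ (m : ℕ) (f v : K → ℝ) : S.form (m + 1) f v =
    ∑ l, (S.r l)⁻¹ * S.form m (fun x => f (S.F l x)) (fun x => v (S.F l x)) := by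
  simp only [form, sum_words_succ, rWord_cons, Fw_cons, mul_inv, Finset.mul_sum, mul_assoc]

theorem form_one (f v : K → ℝ) : S.form 1 f v =
    ∑ l, (S.r l)⁻¹ * form0 (fun i => f (S.F l (S.q i))) (fun i => v (S.F l (S.q i))) := by
  simp only [form_succ, form_zero]

/-- Whereas `form_succ` splits off the first letter of a word, this splits off the last one: the
outer sum is over m-cells, and each of them is refined once. -/
theorem form_succ' (m : ℕ) (f v : K → ℝ) : S.form (m + 1) f v = ∑ w : Fin m → Fin N,
    (S.rWord w)⁻¹ * S.form 1 (fun x => f (S.Fw w x)) (fun x => v (S.Fw w x)) := by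
  induction m generalizing f v with
  | zero => simp [rWord, Fw_zero]
  | succ m ih =>
    rw [form_succ, sum_words_succ]
    refine Finset.sum_congr rfl fun l _ => ?_
    simp only [ih, rWord_cons, Fw_cons, mul_inv, Finset.mul_sum, mul_assoc]

theorem form_comm (m : ℕ) (f v : K → ℝ) : S.form m f v = S.form m v f :=
  Finset.sum_congr rfl fun _ _ => by rw [form0_comm]

theorem form_lin_left (m : ℕ) (f g v : K → ℝ) (c : ℝ) :
    S.form m (fun x => f x + c * g x) v = S.form m f v + c * S.form m g v := by
  simp only [form, Finset.mul_sum, ← Finset.sum_add_distrib]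
  refine Finset.sum_congr rfl fun _ _ => ?_
  simp only [form0]
  ring

theorem form_lin_right (m : ℕ) (f v w : K → ℝ) (c : ℝ) :
    S.form m f (fun x => v x + c * w x) = S.form m f v + c * S.form m f w := by
  rw [form_comm, form_lin_left, S.form_comm m v, S.form_comm m w]

theorem form_self_nonneg (m : ℕ) (f : K → ℝ) : 0 ≤ S.form m f f :=
  Finset.sum_nonneg fun w _ =>
    mul_nonneg (inv_nonneg.2 (S.rWord_pos w).le) (form0_self_nonneg _)

theorem form_congr {m : ℕ} {f g v : K → ℝ} (h : EqOn f g (S.V m)) :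
    S.form m f v = S.form m g v := by
  simp only [form, h (S.mem_V _ _)]

theorem form_zero_le_form_one (f : K → ℝ) : S.form 0 f f ≤ S.form 1 f f := by
  have := (S.energy_restrict (fun i => f (S.q i))).2 ⟨f, fun _ => rfl, rfl⟩
  simpa only [form_zero, form_one, energyZero_eq_form0] using this

theorem form_le_succ (m : ℕ) (f : K → ℝ) : S.form m f f ≤ S.form (m + 1) f f := by
  rw [form_succ']
  refine Finset.sum_le_sum fun w _ =>
    mul_le_mul_of_nonneg_left ?_ (inv_nonneg.2 (S.rWord_pos w).le)
  simpa only [form_zero] using S.form_zero_le_form_one fun x => f (S.Fw w x)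

theorem form_mono (f : K → ℝ) : Monotone fun m => S.form m f f :=
  monotone_nat_of_le_succ fun m => S.form_le_succ m f

theorem exists_minimizer (u : Fin 3 → ℝ) :
    ∃ f : K → ℝ, (∀ i, f (S.q i) = u i) ∧ S.form 1 f f = form0 u u := by
  obtain ⟨f, hf, he⟩ := (S.energy_restrict u).1
  refine ⟨f, hf, ?_⟩
  simpa only [form_one, energyZero_eq_form0] using he.symm

/-- A minimizer of the energy of level `1` satisfies the Euler–Lagrange equation. -/
theorem form_one_eq_of_minimizer {h : K → ℝ} (hh : S.form 1 h h = S.form 0 h h) (v : K → ℝ) :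
    S.form 1 h v = S.form 0 h v := by
  -- The energy gap between levels 1 and 0 at h + t v is a nonnegative quadratic in t. It vanishes
  -- at t = 0 by minimality, so its discriminant forces the linear coefficient to be 0.
  have key : ∀ t : ℝ, 0 ≤ (S.form 1 v v - S.form 0 v v) * (t * t) +
      (2 * (S.form 1 h v - S.form 0 h v)) * t + 0 := by
    intro t
    have h1 := S.form_zero_le_form_one fun x => h x + t * v x
    simp only [form_lin_left, form_lin_right, S.form_comm _ v h] at h1
    nlinarith
  have hd := discrim_le_zero key
  rw [discrim] at hd
  nlinarith [sq_nonneg (S.form 1 h v - S.form 0 h v)]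

/-- Minimality is local. Gluing cellwise minimizers gives a competitor on all of K, and equality of
the total energies then forces equality on every cell. Conversely the cellwise identity gives
E_{m+1}(h) = E_m(h), while E_{m+1}(f) ≥ E_m(f) for every f. -/
theorem isHarmonic_iff [CompactSpace K] (h : K → ℝ) : S.IsHarmonic h ↔ Continuous h ∧
    ∀ (m : ℕ) (w : Fin m → Fin N) (v : K → ℝ),
      S.form 1 (fun x => h (S.Fw w x)) v = S.form 0 (fun x => h (S.Fw w x)) v := by
  refine and_congr_right fun _ => ⟨fun H m w v => S.form_one_eq_of_minimizer ?_ v,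
    fun H m f hf => ?_⟩
  · choose e he he' using fun w : Fin m → Fin N =>
      S.exists_minimizer fun i => h (S.Fw w (S.q i))
    obtain ⟨f, hf, -⟩ := S.exists_glue_cells e fun w w' i k hik => by rw [he, he, hik]
    have hV : EqOn f h (S.V m) := by
      rintro _ ⟨w, i, rfl⟩
      rw [hf, he]
    have h1 := H m f hV
    rw [energy_eq_form, energy_eq_form, form_succ', form_succ'] at h1
    simp only [hf] at h1
    have h2 : ∀ w : Fin m → Fin N, (S.rWord w)⁻¹ * S.form 1 (e w) (e w) ≤
        (S.rWord w)⁻¹ * S.form 1 (fun x => h (S.Fw w x)) (fun x => h (S.Fw w x)) := fun w => by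
      refine mul_le_mul_of_nonneg_left ?_ (inv_nonneg.2 (S.rWord_pos w).le)
      rw [he']
      simpa only [form_zero] using S.form_zero_le_form_one fun x => h (S.Fw w x)
    have h3 := (Finset.sum_eq_sum_iff_of_le fun w _ => h2 w).1
      (le_antisymm (Finset.sum_le_sum fun w _ => h2 w) h1) w (Finset.mem_univ w)
    rw [← mul_left_cancel₀ (inv_ne_zero (S.rWord_pos w).ne') h3, he', form_zero]
  · have h1 : S.form (m + 1) h h = S.form m h h := by
      rw [form_succ']
      simp only [H, form_zero]
      rfl
    rw [energy_eq_form, energy_eq_form, h1, ← S.form_congr hf, form_comm, ← S.form_congr hf]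
    exact S.form_le_succ m f

/-- Tietze extension from the three boundary points. It supplies the starting functions for the
construction of harmonic functions, where only continuity and the range matter. -/
theorem exists_continuous_interpolation (u : Fin 3 → ℝ) : ∃ f : K → ℝ, Continuous f ∧
    (∀ i, f (S.q i) = u i) ∧ ∀ a b, (∀ i, u i ∈ Icc a b) → ∀ x, f x ∈ Icc a b := by
  obtain ⟨i₀, h₀⟩ := Finite.exists_min u
  obtain ⟨i₁, h₁⟩ := Finite.exists_max u
  obtain ⟨g, hg, hgu⟩ := BoundedContinuousFunction.exists_extension_forall_mem_of_isClosedEmbedding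
    (BoundedContinuousFunction.mkOfCompact ⟨u, continuous_of_discreteTopology⟩)
    (t := Icc (u i₀) (u i₁)) (e := S.q) (fun i => ⟨h₀ i, h₁ i⟩) ⟨_, h₀ i₀, h₁ i₀⟩
    (Topology.IsClosedEmbedding.of_continuous_injective_isClosedMap
      continuous_of_discreteTopology S.q_injective fun s _ => (s.toFinite.image _).isClosed)
  refine ⟨g, g.continuous, fun i => congrFun hgu i, fun a b hab x => ?_⟩
  exact ⟨(hab i₀).1.trans (hg x).1, (hg x).2.trans (hab i₁).2⟩

/-- The values on `V_1` of the energy minimizing extension, which may be taken within the range of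
the boundary values. -/
theorem exists_extension_values (u : Fin 3 → ℝ) : ∃ v : Fin N → Fin 3 → ℝ,
    (∀ l l' i k, S.F l (S.q i) = S.F l' (S.q k) → v l i = v l' k) ∧
    (∀ i, v (S.corner i) i = u i) ∧
    ∑ l, (S.r l)⁻¹ * form0 (v l) (v l) = form0 u u ∧
    ∀ a b, (∀ i, u i ∈ Icc a b) → ∀ l i, v l i ∈ Icc a b := by
  obtain ⟨i₀, h₀⟩ := Finite.exists_min u
  obtain ⟨i₁, h₁⟩ := Finite.exists_max u
  obtain ⟨f, hf, he⟩ := S.exists_minimizer u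
  -- Truncation to the range of u does not move the boundary values and does not increase any
  -- squared difference, so the truncated function is still a minimizer.
  set g : K → ℝ := fun x => max (u i₀) (min (u i₁) (f x)) with hg
  have hgq : ∀ i, g (S.q i) = u i := fun i => by
    simp only [hg, hf]
    rw [min_eq_right (h₁ i), max_eq_right (h₀ i)]
  have habs : ∀ x y, (g x - g y) ^ 2 ≤ (f x - f y) ^ 2 := fun x y =>
    sq_le_sq.2 <| by
      simp only [hg, max_comm (u i₀)]
      refine (abs_max_sub_max_le_abs _ _ _).trans ?_
      refine (abs_min_sub_min_le_max _ _ _ _).trans ?_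
      simp
  refine ⟨fun l i => g (S.F l (S.q i)), fun l l' i k h => by simp only [h],
    fun i => (congrArg g (S.FB_q i)).trans (hgq i), ?_, fun a b hab l i => ?_⟩
  · refine le_antisymm ?_ ?_
    · rw [← he, form_one]
      refine Finset.sum_le_sum fun l _ =>
        mul_le_mul_of_nonneg_left ?_ (inv_nonneg.2 (S.r_pos l).le)
      rw [← energyZero_eq_form0, ← energyZero_eq_form0]
      exact add_le_add (add_le_add (habs _ _) (habs _ _)) (habs _ _)
    · have := S.form_zero_le_form_one g
      rw [form_zero, form_one] at this
      simpa only [hgq] using this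
  · have h3 : u i₀ ≤ u i₁ := h₀ i₁
    exact ⟨(hab i₀).1.trans (le_max_left _ _),
      (max_le h3 (min_le_left _ _)).trans (hab i₁).2⟩

variable {S}

theorem IsHarmonic.continuous {h : K → ℝ} (hh : S.IsHarmonic h) : Continuous h := hh.1

section
variable [CompactSpace K]

theorem IsHarmonic.lin {h k : K → ℝ} (hh : S.IsHarmonic h) (hk : S.IsHarmonic k) (c : ℝ) :
    S.IsHarmonic fun x => h x + c * k x := by
  rw [isHarmonic_iff] at *
  refine ⟨hh.1.add (continuous_const.mul hk.1), fun m w v => ?_⟩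
  rw [form_lin_left, form_lin_left, hh.2, hk.2]

theorem isHarmonic_const (c : ℝ) : S.IsHarmonic fun _ => c := by
  rw [isHarmonic_iff]
  refine ⟨continuous_const, fun m w v => ?_⟩
  simp [form, form0]

theorem IsHarmonic.smul {h : K → ℝ} (hh : S.IsHarmonic h) (c : ℝ) :
    S.IsHarmonic fun x => c * h x := by
  simpa using (isHarmonic_const 0).lin hh c

theorem IsHarmonic.comp_F {h : K → ℝ} (hh : S.IsHarmonic h) (l : Fin N) :
    S.IsHarmonic fun x => h (S.F l x) := by
  rw [isHarmonic_iff] at *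
  refine ⟨hh.1.comp (S.F_continuous l), fun m w v => ?_⟩
  have := hh.2 (m + 1) (Fin.cons l w) v
  simpa only [Fw_cons] using this

/-- The cellwise Euler–Lagrange identities chain together over the levels. Taking the indicator of a
vertex for `v` shows that graph Laplacians of harmonic functions vanish off V_0 and do not depend on
the level at the points q_l. -/
theorem IsHarmonic.form_eq {h : K → ℝ} (hh : S.IsHarmonic h) (v : K → ℝ) :
    ∀ m, S.form m h v = S.form 0 h v
  | 0 => rfl
  | m + 1 => by
    rw [← IsHarmonic.form_eq hh v m, form_succ']
    refine Finset.sum_congr rfl fun w _ => ?_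
    rw [((S.isHarmonic_iff h).1 hh).2 m w, form_zero]

/-- Zero energy makes f constant on the vertices of each m-cell. Extended as constants on cells,
these values glue to a continuous function with finite range on the connected space K, which must be
constant. -/
theorem eq_of_form_self_eq_zero {m : ℕ} {f : K → ℝ} (h : S.form m f f = 0) {x y : K}
    (hx : x ∈ S.V m) (hy : y ∈ S.V m) : f x = f y := by
  have hw : ∀ (w : Fin m → Fin N) (i k : Fin 3), f (S.Fw w (S.q i)) = f (S.Fw w (S.q k)) := by
    intro w i k
    have h1 := (Finset.sum_eq_zero_iff_of_nonneg fun w _ =>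
      mul_nonneg (inv_nonneg.2 (S.rWord_pos w).le) (form0_self_nonneg _)).1 h w
        (Finset.mem_univ w)
    have h2 := (mul_eq_zero.1 h1).resolve_left (inv_ne_zero (S.rWord_pos w).ne')
    have h3 := sq_sub_le_form0 (fun i => f (S.Fw w (S.q i))) i k
    rw [h2] at h3
    exact sub_eq_zero.1 (pow_eq_zero_iff two_ne_zero |>.1 (le_antisymm h3 (sq_nonneg _)))
  obtain ⟨g, hg, hc⟩ := S.exists_glue_cells (fun w _ => f (S.Fw w (S.q 0)))
    fun w w' i k hik => by rw [hw w 0 i, hw w' 0 k, hik]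
  replace hc := hc fun _ => continuous_const
  have hgf : ∀ z ∈ S.V m, g z = f z := by
    rintro _ ⟨w, i, rfl⟩
    rw [hg, hw w 0 i]
  rw [← hgf x hx, ← hgf y hy]
  have := S.connected
  by_contra hne
  have hinf := (isPreconnected_range hc).infinite_of_nontrivial
    ⟨_, mem_range_self x, _, mem_range_self y, hne⟩
  refine hinf ((finite_range fun w : Fin m → Fin N => f (S.Fw w (S.q 0))).subset ?_)
  rintro _ ⟨z, rfl⟩
  obtain ⟨w, z', rfl⟩ := S.Fw_cover m z
  exact ⟨w, (hg w z').symm⟩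

theorem eq_zero_of_form_self_eq_zero {m : ℕ} {f : K → ℝ} (h : S.form m f f = 0)
    (h0 : ∀ i, f (S.q i) = 0) {x : K} (hx : x ∈ S.V m) : f x = 0 := by
  rw [← h0 0]
  exact eq_of_form_self_eq_zero h hx (S.q_mem_V m 0)

theorem IsHarmonic.eq_zero {h : K → ℝ} (hh : S.IsHarmonic h) (h0 : ∀ i, h (S.q i) = 0) :
    h = fun _ => 0 := by
  refine S.eq_of_eqOn_V hh.continuous continuous_const fun m x hx => ?_
  refine eq_zero_of_form_self_eq_zero (m := m) ?_ h0 hx.1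
  rw [hh.form_eq, form_zero]
  simp [h0, form0]

theorem IsHarmonic.ext {h k : K → ℝ} (hh : S.IsHarmonic h) (hk : S.IsHarmonic k)
    (h0 : ∀ i, h (S.q i) = k (S.q i)) : h = k := by
  have := (hh.lin hk (-1)).eq_zero fun i => by rw [h0]; ring
  funext x
  linarith [congrFun this x]

/-! ### Existence of harmonic functions with given boundary values. -/

variable (S)

/-- Successive approximations of the harmonic functions. -/
theorem exists_approximations : ∃ (A : (Fin 3 → ℝ) → Fin N → Fin 3 → ℝ)
    (f : ℕ → (Fin 3 → ℝ) → K → ℝ) (R : ℝ), 0 ≤ R ∧ R < 1 ∧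
    (∀ u, ∑ l, (S.r l)⁻¹ * form0 (A u l) (A u l) = form0 u u) ∧
    (∀ n u, Continuous (f n u)) ∧ (∀ n u i, f n u (S.q i) = u i) ∧
    (∀ n u l x, f (n + 1) u (S.F l x) = f n (A u l) x) ∧
    (∀ n u x, dist (f n u x) (f (n + 1) u x) ≤ √(form0 u u) * R ^ n) := by
  choose A hA hAc hAe hAb using S.exists_extension_values
  choose f₀ hf₀ hf₀q hf₀b using S.exists_continuous_interpolation
  have step : ∀ f : {f : (Fin 3 → ℝ) → K → ℝ // ∀ u, Continuous (f u) ∧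
      ∀ i, f u (S.q i) = u i}, ∃ f' : {f : (Fin 3 → ℝ) → K → ℝ // ∀ u, Continuous (f u) ∧
      ∀ i, f u (S.q i) = u i}, ∀ u l x, f'.1 u (S.F l x) = f.1 (A u l) x := by
    rintro ⟨f, hf⟩
    choose g hg hgc using fun u => S.exists_glue_one (fun l => f (A u l)) fun l l' i k h => by
      rw [(hf _).2, (hf _).2, hA u l l' i k h]
    refine ⟨⟨g, fun u => ⟨hgc u fun l => (hf _).1, fun i => ?_⟩⟩, hg⟩
    have := hg u (S.corner i) (S.q i)
    rw [(hf _).2, hAc] at this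
    exact (congrArg (g u) (S.FB_q i)).symm.trans this
  choose next hnext using step
  set f : ℕ → {f : (Fin 3 → ℝ) → K → ℝ // ∀ u, Continuous (f u) ∧ ∀ i, f u (S.q i) = u i} :=
    fun n => Nat.rec ⟨f₀, fun u => ⟨hf₀ u, hf₀q u⟩⟩ (fun _ f => next f) n
  have hf : ∀ n u l x, (f (n + 1)).1 u (S.F l x) = (f n).1 (A u l) x :=
    fun n => hnext (f n)
  have : Nonempty (Fin N) := ⟨S.corner 0⟩
  obtain ⟨l₀, hl₀⟩ := Finite.exists_max S.r
  -- One summand is at most the whole energy, so passing to a 1-cell contracts the level-0 energy by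
  -- the largest r_l. The square root of this factor is the geometric rate R.
  have hAr : ∀ u l, form0 (A u l) (A u l) ≤ S.r l₀ * form0 u u := by
    intro u l
    have h1 : (S.r l)⁻¹ * form0 (A u l) (A u l) ≤ form0 u u := by
      rw [← hAe u]
      exact Finset.single_le_sum (f := fun l => (S.r l)⁻¹ * form0 (A u l) (A u l))
        (fun l _ => mul_nonneg (inv_nonneg.2 (S.r_pos l).le) (form0_self_nonneg _))
        (Finset.mem_univ l)
    rw [inv_mul_le_iff₀ (S.r_pos l)] at h1
    exact h1.trans (mul_le_mul_of_nonneg_right (hl₀ l) (form0_self_nonneg _))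
  refine ⟨A, fun n => (f n).1, √(S.r l₀), Real.sqrt_nonneg _, ?_, hAe, fun n u => ((f n).2 u).1,
    fun n u => ((f n).2 u).2, hf, fun n => ?_⟩
  · rw [Real.sqrt_lt' one_pos]
    simpa using S.r_lt_one l₀
  · induction n with
    | zero =>
      intro u x
      -- Both approximants take values between the extreme boundary values, whose difference is at
      -- most the square root of the energy.
      obtain ⟨i₀, h₀⟩ := Finite.exists_min u
      obtain ⟨i₁, h₁⟩ := Finite.exists_max u
      have h2 : (f 0).1 u x ∈ Icc (u i₀) (u i₁) := hf₀b u _ _ (fun i => ⟨h₀ i, h₁ i⟩) x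
      have h3 : (f 1).1 u x ∈ Icc (u i₀) (u i₁) := by
        obtain ⟨l, y, rfl⟩ := S.F_cover x
        refine (hf 0 u l y).symm ▸ ?_
        exact hf₀b _ _ _ (hAb u _ _ (fun i => ⟨h₀ i, h₁ i⟩) l) y
      rw [pow_zero, mul_one]
      refine (Real.dist_le_of_mem_Icc h2 h3).trans (Real.le_sqrt_of_sq_le ?_)
      exact sq_sub_le_form0 u i₁ i₀
    | succ n ih =>
      intro u x
      obtain ⟨l, y, rfl⟩ := S.F_cover x
      show dist ((f (n + 1)).1 u _) ((f (n + 1 + 1)).1 u _) ≤ _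
      rw [hf n, hf (n + 1)]
      refine (ih (A u l) y).trans ?_
      have h2 : √(form0 (A u l) (A u l)) ≤ √(S.r l₀) * √(form0 u u) := by
        rw [← Real.sqrt_mul (S.r_pos l₀).le]
        exact Real.sqrt_le_sqrt (hAr u l)
      calc _ ≤ (√(S.r l₀) * √(form0 u u)) * √(S.r l₀) ^ n := by gcongr
        _ = _ := by ring

/-- The uniform limits satisfy h_u ∘ F_l = h_{A u l}. Hence on every cell the limit is again some
h_{u'}, whose energies at levels 0 and 1 agree; no linearity of the choice A is needed. -/
theorem exists_isHarmonic (u : Fin 3 → ℝ) : ∃ h, S.IsHarmonic h ∧ ∀ i, h (S.q i) = u i := by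
  obtain ⟨A, f, R, hR0, hR1, hAe, hfc, hfq, hf, hd⟩ := S.exists_approximations
  have hlim : ∀ u x, ∃ y, Tendsto (fun n => f n u x) atTop (𝓝 y) := fun u x =>
    cauchySeq_tendsto_of_complete (cauchySeq_of_le_geometric R _ hR1 fun n => hd n u x)
  choose h hh using hlim
  have hc : ∀ u, Continuous (h u) := by
    intro u
    have hu : TendstoUniformly (fun n => f n u) (h u) atTop := by
      rw [Metric.tendstoUniformly_iff]
      intro ε hε
      have ht : Tendsto (fun n : ℕ => √(form0 u u) * R ^ n / (1 - R)) atTop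
          (𝓝 (√(form0 u u) * 0 / (1 - R))) :=
        ((tendsto_pow_atTop_nhds_zero_of_lt_one hR0 hR1).const_mul _).div_const _
      rw [mul_zero, zero_div] at ht
      filter_upwards [ht.eventually_lt_const hε] with n hn x
      rw [dist_comm]
      exact (dist_le_of_le_geometric_of_tendsto R _ hR1 (fun n => hd n u x) (hh u x) n).trans_lt hn
    exact hu.continuous (Frequently.of_forall fun n => hfc n u)
  have hq : ∀ u i, h u (S.q i) = u i := fun u i =>
    tendsto_nhds_unique (hh u _) (by simp only [hfq]; exact tendsto_const_nhds)
  have hF : ∀ u l x, h u (S.F l x) = h (A u l) x := fun u l x =>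
    tendsto_nhds_unique ((tendsto_add_atTop_iff_nat 1).2 (hh u (S.F l x)))
      (by simpa only [hf] using hh (A u l) x)
  have hw : ∀ m (w : Fin m → Fin N) u, ∃ u', ∀ x, h u (S.Fw w x) = h u' x := by
    intro m
    induction m with
    | zero => exact fun w u => ⟨u, fun x => rfl⟩
    | succ m ih =>
      intro w u
      obtain ⟨u', hu'⟩ := ih (Fin.tail w) (A u (w 0))
      exact ⟨u', fun x => by rw [Fw_succ, hF, hu']⟩
  refine ⟨h u, (S.isHarmonic_iff _).2 ⟨hc u, fun m w v => ?_⟩, hq u⟩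
  obtain ⟨u', hu'⟩ := hw m w u
  simp only [hu']
  refine S.form_one_eq_of_minimizer ?_ v
  simp only [form_one, form_zero, hF, hq, hAe]

theorem isHarmonic_harmonicExt (u : Fin 3 → ℝ) : S.IsHarmonic (S.harmonicExt u) :=
  (Classical.epsilon_spec (S.exists_isHarmonic u)).1

theorem harmonicExt_q (u : Fin 3 → ℝ) (i : Fin 3) : S.harmonicExt u (S.q i) = u i :=
  (Classical.epsilon_spec (S.exists_isHarmonic u)).2 i

variable {S}

theorem IsHarmonic.eq_sum {h : K → ℝ} (hh : S.IsHarmonic h) (x : K) :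
    h x = ∑ k, S.harmonicExt (Pi.single k 1) x * h (S.q k) := by
  have h1 := ((((isHarmonic_const 0).lin (S.isHarmonic_harmonicExt (Pi.single 0 1)) (h (S.q 0))).lin
    (S.isHarmonic_harmonicExt (Pi.single 1 1)) (h (S.q 1))).lin
    (S.isHarmonic_harmonicExt (Pi.single 2 1)) (h (S.q 2)))
  have h2 := congrFun (hh.ext h1 fun i => by
    simp only [harmonicExt_q]
    fin_cases i <;> simp) x
  rw [h2, Fin.sum_univ_three]
  ring

end

end HarmonicPCF

end

/-! ### Graph Laplacians and masses as sums over the cells at a vertex. -/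

noncomputable section

/-- The Laplacian at the vertex `i` of the complete graph on three vertices. -/
def lapAt (u : Fin 3 → ℝ) (i : Fin 3) : ℝ := ∑ k, (u k - u i)

theorem lapAt_eq (u : Fin 3 → ℝ) (i : Fin 3) : lapAt u i = ∑ k, u k - 3 * u i := by
  simp [lapAt, Finset.sum_sub_distrib]

theorem lapAt_perm (u : Fin 3 → ℝ) (τ : Equiv.Perm (Fin 3)) (i : Fin 3) :
    lapAt (fun k => u (τ k)) i = lapAt u (τ i) :=
  Equiv.sum_comp τ fun k => u k - u (τ i)

theorem form0_eq_neg_sum_lapAt (a b : Fin 3 → ℝ) : form0 a b = -∑ i, b i * lapAt a i := by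
  simp only [form0, lapAt, Fin.sum_univ_three]
  ring

theorem form0_perm (a b : Fin 3 → ℝ) (τ : Equiv.Perm (Fin 3)) :
    form0 (fun i => a (τ i)) (fun i => b (τ i)) = form0 a b := by
  simp only [form0_eq_neg_sum_lapAt, lapAt_perm]
  rw [Equiv.sum_comp τ fun i => b i * lapAt a i]

namespace HarmonicPCF

variable {K : Type*} [MetricSpace K] {N : ℕ} (S : HarmonicPCF K N)

theorem muWord_cons {m : ℕ} (l : Fin N) (w : Fin m → Fin N) :
    S.muWord (Fin.cons l w) = S.mu l * S.muWord w := by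
  simp [muWord, Fin.prod_univ_succ]

theorem muWord_pos {m : ℕ} (w : Fin m → Fin N) : 0 < S.muWord w :=
  Finset.prod_pos fun _ _ => S.mu_pos _

theorem sum_muWord : ∀ m : ℕ, ∑ w : Fin m → Fin N, S.muWord w = 1
  | 0 => by simp [muWord]
  | m + 1 => by
    simp only [sum_words_succ, muWord_cons, ← Finset.mul_sum, sum_muWord m, mul_one, S.mu_sum]

open Classical in
/-- The sum of `φ w i` over the pairs `(w, i)` such that `x` is the vertex `F_w q_i`. -/
def vsum (m : ℕ) (φ : (Fin m → Fin N) → Fin 3 → ℝ) (x : K) : ℝ :=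
  ∑ w, ∑ i, if S.Fw w (S.q i) = x then φ w i else 0

/-- The integral of the tent function `ψ_x^m`. -/
def mass (m : ℕ) (x : K) : ℝ := S.vsum m (fun w _ => S.muWord w / 3) x

theorem graphLaplacian_eq (m : ℕ) (f : K → ℝ) (x : K) : S.graphLaplacian m f x =
    S.vsum m (fun w i => (S.rWord w)⁻¹ * lapAt (fun k => f (S.Fw w (S.q k))) i) x := by
  refine Finset.sum_congr rfl fun w _ => Finset.sum_congr rfl fun i _ => ?_
  split_ifs with h
  · subst h
    simp only [lapAt, Finset.mul_sum]
  · simp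

theorem vsum_congr {m : ℕ} {φ φ' : (Fin m → Fin N) → Fin 3 → ℝ} {x : K}
    (h : ∀ w i, S.Fw w (S.q i) = x → φ w i = φ' w i) : S.vsum m φ x = S.vsum m φ' x := by
  refine Finset.sum_congr rfl fun w _ => Finset.sum_congr rfl fun i _ => ?_
  split_ifs with hx
  · exact h w i hx
  · rfl

theorem mul_vsum (m : ℕ) (φ : (Fin m → Fin N) → Fin 3 → ℝ) (x : K) (c : ℝ) :
    c * S.vsum m φ x = S.vsum m (fun w i => c * φ w i) x := by
  simp only [vsum, Finset.mul_sum, mul_ite, mul_zero]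

theorem vsum_add (m : ℕ) (φ φ' : (Fin m → Fin N) → Fin 3 → ℝ) (x : K) :
    S.vsum m (fun w i => φ w i + φ' w i) x = S.vsum m φ x + S.vsum m φ' x := by
  simp only [vsum, ← Finset.sum_add_distrib]
  refine Finset.sum_congr rfl fun w _ => Finset.sum_congr rfl fun i _ => ?_
  split_ifs <;> simp

theorem graphLaplacian_lin (m : ℕ) (f g : K → ℝ) (c : ℝ) (x : K) :
    S.graphLaplacian m (fun y => f y + c * g y) x =
      S.graphLaplacian m f x + c * S.graphLaplacian m g x := by
  simp only [graphLaplacian_eq, mul_vsum, ← vsum_add]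
  refine S.vsum_congr fun w i _ => ?_
  simp only [lapAt, Fin.sum_univ_three]
  ring

theorem graphLaplacian_congr {m : ℕ} {f g : K → ℝ} (h : EqOn f g (S.V m)) (x : K) :
    S.graphLaplacian m f x = S.graphLaplacian m g x := by
  simp only [graphLaplacian_eq, h (S.mem_V _ _)]

theorem mass_pos {m : ℕ} {x : K} (hx : x ∈ S.V m) : 0 < S.mass m x := by
  classical
  obtain ⟨w, i, h⟩ := hx
  have hn : ∀ (w : Fin m → Fin N) (i : Fin 3),
      0 ≤ if S.Fw w (S.q i) = x then S.muWord w / 3 else 0 := fun w i => by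
    have := S.muWord_pos w
    split_ifs <;> positivity
  refine Finset.sum_pos' (fun w _ => Finset.sum_nonneg fun i _ => ?_)
    ⟨w, Finset.mem_univ w, Finset.sum_pos' (fun i _ => ?_) ⟨i, Finset.mem_univ i, ?_⟩⟩
  · convert hn w i
  · convert hn w i
  · rw [if_pos h]
    have := S.muWord_pos w
    positivity

/-- The vertices of level `m`. -/
def vertices (m : ℕ) : Finset K :=
  (finite_range fun p : (Fin m → Fin N) × Fin 3 => S.Fw p.1 (S.q p.2)).toFinset

theorem mem_vertices {m : ℕ} {x : K} : x ∈ S.vertices m ↔ x ∈ S.V m := by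
  simp [vertices, V]

theorem sum_vsum (m : ℕ) (v : K → ℝ) (φ : (Fin m → Fin N) → Fin 3 → ℝ) :
    ∑ x ∈ S.vertices m, v x * S.vsum m φ x = ∑ w, ∑ i, v (S.Fw w (S.q i)) * φ w i := by
  classical
  simp only [vsum, Finset.mul_sum]
  rw [Finset.sum_comm]
  refine Finset.sum_congr rfl fun w _ => ?_
  rw [Finset.sum_comm]
  refine Finset.sum_congr rfl fun i _ => ?_
  rw [Finset.sum_eq_single (S.Fw w (S.q i))]
  · simp
  · intro x _ hx
    simp [hx.symm]
  · intro h
    exact absurd (S.mem_vertices.2 (S.mem_V w i)) h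

theorem sum_mass (m : ℕ) : ∑ x ∈ S.vertices m, S.mass m x = 1 := by
  have := S.sum_vsum m (fun _ => 1) fun w _ => S.muWord w / 3
  simp only [one_mul] at this
  rw [← S.sum_muWord m]
  refine this.trans (Finset.sum_congr rfl fun w _ => ?_)
  rw [Fin.sum_univ_three]
  ring

/-- Summation by parts. -/
theorem form_eq_neg_sum (m : ℕ) (f v : K → ℝ) :
    S.form m f v = -∑ x ∈ S.vertices m, v x * S.graphLaplacian m f x := by
  simp only [graphLaplacian_eq]
  rw [sum_vsum, form, ← Finset.sum_neg_distrib]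
  refine Finset.sum_congr rfl fun w _ => ?_
  rw [form0_eq_neg_sum_lapAt, mul_neg, Finset.mul_sum]
  exact congrArg Neg.neg (Finset.sum_congr rfl fun i _ => by ring)

/-- Different 1-cells meet only in images of V_0, so every (m+1)-cell at F_l x lies inside F_l K. -/
theorem vsum_F (m : ℕ) (φ : (Fin (m + 1) → Fin N) → Fin 3 → ℝ) (l : Fin N) {x : K}
    (hx : x ∉ S.V 0) :
    S.vsum (m + 1) φ (S.F l x) = S.vsum m (fun w => φ (Fin.cons l w)) x := by
  classical
  simp only [vsum, sum_words_succ, Fw_cons]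
  rw [Finset.sum_eq_single l]
  · simp only [(S.injective l).eq_iff]
  · intro l' _ hl
    refine Finset.sum_eq_zero fun w _ => Finset.sum_eq_zero fun i _ => if_neg fun h => ?_
    obtain ⟨i, k, -, hk⟩ := S.F_inter hl h
    exact hx (hk ▸ S.q_mem_V_zero k)
  · intro h
    exact absurd (Finset.mem_univ l) h

/-- The cells of level `m + 1` at a vertex of level `1` are the corner cells of the `1`-cells. -/
theorem vsum_succ_of_mem (m : ℕ) (φ : (Fin (m + 1) → Fin N) → Fin 3 → ℝ) {x : K}
    (hx : x ∈ S.V 1) : S.vsum (m + 1) φ x =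
      S.vsum 1 (fun w k => φ (Fin.cons (w 0) fun _ => S.corner k) k) x := by
  classical
  simp only [vsum, sum_words_succ, Fw_cons, Fw_zero, Finset.univ_unique, Finset.sum_singleton,
    Fin.cons_zero]
  refine Finset.sum_congr rfl fun l _ => ?_
  by_cases h : ∃ k, S.F l (S.q k) = x
  · obtain ⟨k, rfl⟩ := h
    have h1 : ∀ (w : Fin m → Fin N) (i : Fin 3), S.F l (S.Fw w (S.q i)) = S.F l (S.q k) ↔
        w = (fun _ => S.corner k) ∧ i = k := by
      intro w i
      rw [(S.injective l).eq_iff]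
      constructor
      · intro h
        exact ⟨(S.Fw_eq_q h).1, S.q_injective (S.Fw_eq_q h).2⟩
      · rintro ⟨rfl, rfl⟩
        rw [Fw_corner, FB_iterate_q]
    simp only [h1, (S.injective l).eq_iff, S.q_injective.eq_iff, ite_and, Finset.sum_ite_eq',
      Finset.mem_univ, if_true]
    rw [Finset.sum_eq_single (fun _ => S.corner k)]
    · simp
    · intro w _ hw
      simp [hw]
    · simp
  · rw [Finset.sum_eq_zero, Finset.sum_eq_zero]
    · intro k _
      exact if_neg fun hk => h ⟨k, hk⟩
    · intro w _
      refine Finset.sum_eq_zero fun i _ => if_neg fun hi => h ?_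
      obtain ⟨w', k', rfl⟩ := hx
      rw [Fw_one] at hi
      by_cases hl : l = w' 0
      · exact ⟨k', by rw [hl, Fw_one]⟩
      · obtain ⟨k, -, hk, -⟩ := S.F_inter hl hi
        exact ⟨k, by rw [← hk, hi, Fw_one]⟩

/-! ### Invariance under symmetries. -/

variable {S}

/-- A symmetry is only given through an image word for each word. Injectivity on K and on words
makes this a permutation of the words, together with a permutation of the three vertices of each
cell; invariant sums can then be reindexed. -/
theorem IsSymmetry.exists_reindex {g : K ≃ₜ K} (hg : S.IsSymmetry g) (m : ℕ) :
    ∃ (e : (Fin m → Fin N) ≃ (Fin m → Fin N)) (τ : (Fin m → Fin N) → Equiv.Perm (Fin 3)),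
      ∀ w, (∀ i, g (S.Fw w (S.q i)) = S.Fw (e w) (S.q (τ w i))) ∧
        S.rWord (e w) = S.rWord w ∧ S.muWord (e w) = S.muWord w := by
  choose e he1 he2 he3 he4 using hg m
  have hinj : Function.Injective e := fun w w' h => by
    refine S.Fw_range_injective (g.injective.image_injective ?_)
    rw [he1, he1, h]
  have ht : ∀ w i, ∃ k, g (S.Fw w (S.q i)) = S.Fw (e w) (S.q k) := fun w i => by
    have : g (S.Fw w (S.q i)) ∈ g '' (S.Fw w '' range S.q) :=
      mem_image_of_mem _ (mem_image_of_mem _ (mem_range_self i))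
    rw [he2] at this
    obtain ⟨_, ⟨k, rfl⟩, hk⟩ := this
    exact ⟨k, hk.symm⟩
  choose τ hτ using ht
  have hτi : ∀ w, Function.Injective (τ w) := fun w i k h =>
    S.q_injective (S.Fw_injective w (g.injective (by rw [hτ, hτ, h])))
  exact ⟨Equiv.ofBijective e (Finite.injective_iff_bijective.1 hinj),
    fun w => Equiv.ofBijective (τ w) (Finite.injective_iff_bijective.1 (hτi w)),
    fun w => ⟨hτ w, he3 w, he4 w⟩⟩

theorem IsSymmetry.mem_V_iff {g : K ≃ₜ K} (hg : S.IsSymmetry g) {m : ℕ} {x : K} :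
    g x ∈ S.V m ↔ x ∈ S.V m := by
  obtain ⟨e, τ, h⟩ := hg.exists_reindex m
  constructor
  · rintro ⟨w, i, hw⟩
    refine ⟨e.symm w, (τ (e.symm w)).symm i, g.injective ?_⟩
    rw [(h _).1, Equiv.apply_symm_apply, Equiv.apply_symm_apply, hw]
  · rintro ⟨w, i, rfl⟩
    rw [(h w).1]
    exact S.mem_V _ _

theorem IsSymmetry.form_comp {g : K ≃ₜ K} (hg : S.IsSymmetry g) (m : ℕ) (f v : K → ℝ) :
    S.form m (fun x => f (g x)) (fun x => v (g x)) = S.form m f v := by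
  obtain ⟨e, τ, h⟩ := hg.exists_reindex m
  refine Eq.trans (Finset.sum_congr rfl fun w _ => ?_) (Equiv.sum_comp e _)
  simp only [(h w).1, (h w).2.1]
  rw [form0_perm (fun i => f (S.Fw (e w) (S.q i))) (fun i => v (S.Fw (e w) (S.q i)))]

theorem IsHarmonic.comp_symmetry {h : K → ℝ} (hh : S.IsHarmonic h) {g : K ≃ₜ K}
    (hg : S.IsSymmetry g) : S.IsHarmonic fun x => h (g x) := by
  refine ⟨hh.1.comp g.continuous, fun m f hf => ?_⟩
  have h1 := hh.2 m (fun x => f (g.symm x)) fun x hx => by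
    rw [hf _ (hg.mem_V_iff.1 (by rwa [g.apply_symm_apply]))]
    simp only [g.apply_symm_apply]
  rw [energy_eq_form, energy_eq_form, ← hg.form_comp (m + 1) h,
    ← hg.form_comp (m + 1) fun x => f (g.symm x)] at h1
  simpa only [g.symm_apply_apply, energy_eq_form] using h1

theorem IsSymmetry.graphLaplacian_comp {g : K ≃ₜ K} (hg : S.IsSymmetry g) (m : ℕ) (f : K → ℝ)
    (x : K) : S.graphLaplacian m (fun y => f (g y)) x = S.graphLaplacian m f (g x) := by
  obtain ⟨e, τ, h⟩ := hg.exists_reindex m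
  classical
  rw [graphLaplacian_eq, graphLaplacian_eq]
  refine Eq.trans (Finset.sum_congr rfl fun w _ => ?_) (Equiv.sum_comp e _)
  refine Eq.trans (Finset.sum_congr rfl fun i _ => ?_) (Equiv.sum_comp (τ w) _)
  have hiff : S.Fw (e w) (S.q (τ w i)) = g x ↔ S.Fw w (S.q i) = x := by
    rw [← (h w).1, g.injective.eq_iff]
  refine if_congr hiff.symm ?_ rfl
  beta_reduce
  simp only [(h w).1, (h w).2.1]
  rw [lapAt_perm fun k => f (S.Fw (e w) (S.q k))]

theorem IsSymmetry.mass_comp {g : K ≃ₜ K} (hg : S.IsSymmetry g) (m : ℕ) (x : K) :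
    S.mass m (g x) = S.mass m x := by
  obtain ⟨e, τ, h⟩ := hg.exists_reindex m
  classical
  refine (Equiv.sum_comp e _).symm.trans (Finset.sum_congr rfl fun w _ => ?_)
  refine (Equiv.sum_comp (τ w) _).symm.trans (Finset.sum_congr rfl fun i _ => ?_)
  have hiff : S.Fw (e w) (S.q (τ w i)) = g x ↔ S.Fw w (S.q i) = x := by
    rw [← (h w).1, g.injective.eq_iff]
  exact if_congr hiff (by beta_reduce; rw [(h w).2.2]) rfl

theorem IsSymmetry.sum_comp {g : K ≃ₜ K} (hg : S.IsSymmetry g) (m : ℕ) (f : K → ℝ) :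
    ∑ w : Fin m → Fin N, S.muWord w * ∑ i, f (g (S.Fw w (S.q i))) =
      ∑ w : Fin m → Fin N, S.muWord w * ∑ i, f (S.Fw w (S.q i)) := by
  obtain ⟨e, τ, h⟩ := hg.exists_reindex m
  refine Eq.trans (Finset.sum_congr rfl fun w _ => ?_) (Equiv.sum_comp e _)
  simp only [(h w).1, (h w).2.2]
  rw [Equiv.sum_comp (τ w) fun i => f (S.Fw (e w) (S.q i))]

/-- Since q_k lies in a single m-cell, corner cells go to corner cells. The permutation of the
vertices may depend on the level m. -/
theorem IsSymmetry.exists_corner_perm {g : K ≃ₜ K} (hg : S.IsSymmetry g) {l k : Fin 3}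
    (hlk : g (S.q l) = S.q k) (m : ℕ) : ∃ τ : Equiv.Perm (Fin 3), τ l = k ∧
      ∀ i, g ((S.FB l)^[m] (S.q i)) = (S.FB k)^[m] (S.q (τ i)) := by
  obtain ⟨e, τ, h⟩ := hg.exists_reindex m
  have h1 := (h fun _ => S.corner l).1
  have h2 := h1 l
  rw [Fw_corner, FB_iterate_q, hlk] at h2
  obtain ⟨h3, h4⟩ := S.Fw_eq_q h2.symm
  refine ⟨τ _, S.q_injective h4, fun i => ?_⟩
  rw [← Fw_corner, h1, h3, Fw_corner]

theorem IsSymmetry.r_corner {g : K ≃ₜ K} (hg : S.IsSymmetry g) {l k : Fin 3}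
    (hlk : g (S.q l) = S.q k) : S.r (S.corner k) = S.r (S.corner l) := by
  obtain ⟨e, τ, h⟩ := hg.exists_reindex 1
  have h1 := h fun _ => S.corner l
  have h2 := h1.1 l
  rw [Fw_corner, FB_iterate_q, hlk] at h2
  have h3 := h1.2.1
  rw [(S.Fw_eq_q h2.symm).1] at h3
  simpa [rWord] using h3

/-! ### Integrals of harmonic functions and of tent functions. -/

section
variable [CompactSpace K]

/-- The left side is a linear functional of the three boundary values, and D3 symmetry makes its
three coefficients equal. The constant function 1 shows that they are 1. -/
theorem IsHarmonic.sum_muWord (hD3 : S.IsD3Symmetric) {h : K → ℝ} (hh : S.IsHarmonic h) (m : ℕ) :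
    ∑ w : Fin m → Fin N, S.muWord w * ∑ i, h (S.Fw w (S.q i)) = ∑ i, h (S.q i) := by
  set A : (K → ℝ) → ℝ := fun f => ∑ w : Fin m → Fin N, S.muWord w * ∑ i, f (S.Fw w (S.q i)) with hA
  set e : Fin 3 → K → ℝ := fun k => S.harmonicExt (Pi.single k 1) with he
  have hlin : ∀ f : K → ℝ, S.IsHarmonic f → A f = ∑ k, f (S.q k) * A (e k) := by
    intro f hf
    have h1 : ∀ w : Fin m → Fin N, ∑ i, f (S.Fw w (S.q i)) =
        ∑ k, f (S.q k) * ∑ i, e k (S.Fw w (S.q i)) := by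
      intro w
      simp only [Finset.mul_sum]
      rw [Finset.sum_comm]
      refine Finset.sum_congr rfl fun i _ => ?_
      rw [hf.eq_sum (S.Fw w (S.q i))]
      exact Finset.sum_congr rfl fun k _ => mul_comm _ _
    simp only [hA, h1]
    simp only [Fin.sum_univ_three, Finset.mul_sum, ← Finset.sum_add_distrib]
    exact Finset.sum_congr rfl fun w _ => by ring
  have hsym : ∀ k, A (e k) = A (e 0) := by
    intro k
    obtain ⟨g, hgq, hg⟩ := hD3 (Equiv.swap k 0)
    have h1 : e k = fun x => e 0 (g x) := by
      refine (S.isHarmonic_harmonicExt _).ext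
        ((S.isHarmonic_harmonicExt _).comp_symmetry hg) fun i => ?_
      rw [hgq]
      simp only [he, harmonicExt_q, Pi.single_apply]
      simp [Equiv.swap_apply_eq_iff]
    rw [h1]
    exact hg.sum_comp m (e 0)
  have h1 : A (fun _ => 1) = 3 := by
    simp only [hA, Finset.sum_const, Finset.card_univ, Fintype.card_fin, ← Finset.sum_mul,
      S.sum_muWord]
    norm_num
  have h2 := hlin _ (isHarmonic_const 1)
  simp only [hsym, h1, Fin.sum_univ_three] at h2
  have h3 : A (e 0) = 1 := by linarith
  have h4 := hlin h hh
  simp only [hsym, h3, mul_one] at h4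
  exact h4

variable (S) in
theorem exists_isTent (m : ℕ) (x : K) (hx : x ∈ S.V m) : ∃ ψ, S.IsTent m x ψ := by
  classical
  set u : (Fin m → Fin N) → Fin 3 → ℝ := fun w i => if S.Fw w (S.q i) = x then 1 else 0 with hu
  obtain ⟨ψ, hψ, -⟩ := S.exists_glue_cells (fun w => S.harmonicExt (u w)) fun w w' i k h => by
    simp only [harmonicExt_q, hu, h]
  refine ⟨ψ, fun w => ?_, ?_, ?_⟩
  · have : ψ ∘ S.Fw w = S.harmonicExt (u w) := funext fun y => hψ w y
    rw [this]
    exact S.isHarmonic_harmonicExt _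
  · obtain ⟨w, i, rfl⟩ := hx
    rw [hψ, harmonicExt_q]
    simp [hu]
  · rintro _ ⟨w, i, rfl⟩ hne
    rw [hψ, harmonicExt_q]
    simp [hu, hne]

theorem continuous_of_comp_Fw {m : ℕ} {f : K → ℝ}
    (hf : ∀ w : Fin m → Fin N, Continuous fun x => f (S.Fw w x)) : Continuous f := by
  obtain ⟨f', h1, h2⟩ := S.exists_glue_cells (fun w x => f (S.Fw w x))
    fun w w' i k h => by rw [h]
  have : f = f' := by
    funext x
    obtain ⟨w, y, rfl⟩ := S.Fw_cover m x
    rw [h1]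
  rw [this]
  exact h2 hf

variable [MeasurableSpace K] [BorelSpace K] {ν : Measure K}

theorem IsSelfSimilarMeasure.integral_F (hν : S.IsSelfSimilarMeasure ν) {f : K → ℝ}
    (hf : Continuous f) : ∫ x, f x ∂ν = ∑ l, S.mu l * ∫ x, f (S.F l x) ∂ν := by
  have := hν.1
  have hm : ∀ l, Measurable (S.F l) := fun l => (S.F_continuous l).measurable
  have h1 : ν = ∑ l, ENNReal.ofReal (S.mu l) • ν.map (S.F l) := by
    ext A hA
    rw [hν.2 A hA]
    simp [Measure.map_apply (hm _) hA]
  have hint : ∀ l, Integrable f (ν.map (S.F l)) := fun l => by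
    have : IsFiniteMeasure (ν.map (S.F l)) := inferInstance
    exact hf.integrable_of_hasCompactSupport (HasCompactSupport.of_compactSpace f)
  conv_lhs => rw [h1]
  rw [integral_finsetSum_measure fun l _ => (hint l).smul_measure ENNReal.ofReal_ne_top]
  refine Finset.sum_congr rfl fun l _ => ?_
  rw [integral_smul_measure, ENNReal.toReal_ofReal (S.mu_pos l).le,
    integral_map (hm l).aemeasurable hf.aestronglyMeasurable, smul_eq_mul]

theorem IsSelfSimilarMeasure.integral_Fw (hν : S.IsSelfSimilarMeasure ν) (m : ℕ) {f : K → ℝ}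
    (hf : Continuous f) :
    ∫ x, f x ∂ν = ∑ w : Fin m → Fin N, S.muWord w * ∫ x, f (S.Fw w x) ∂ν := by
  induction m generalizing f with
  | zero => simp [muWord, Fw_zero]
  | succ m ih =>
    rw [hν.integral_F hf, sum_words_succ]
    refine Finset.sum_congr rfl fun l _ => ?_
    rw [ih (f := fun x => f (S.F l x)) (hf.comp (S.F_continuous l))]
    simp only [muWord_cons, Fw_cons, Finset.mul_sum, mul_assoc]

/-- The vertex averages with weights μ_w / 3 are Riemann sums for the integral, and by `sum_muWord`
they equal the boundary mean at every level. -/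
theorem IsHarmonic.integral_eq (hD3 : S.IsD3Symmetric) (hν : S.IsSelfSimilarMeasure ν)
    {h : K → ℝ} (hh : S.IsHarmonic h) : ∫ x, h x ∂ν = (∑ i, h (S.q i)) / 3 := by
  have := hν.1
  refine eq_of_forall_dist_le fun ε hε => ?_
  obtain ⟨δ, hδ, hu⟩ := Metric.uniformContinuous_iff.1
    (CompactSpace.uniformContinuous_of_continuous hh.continuous) ε hε
  obtain ⟨m, hm⟩ := S.exists_level_dist_lt hδ
  have hosc : ∀ (w : Fin m → Fin N) x y, |h (S.Fw w x) - h (S.Fw w y)| ≤ ε := fun w x y =>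
    (hu (hm m le_rfl w x y)).le
  rw [hν.integral_Fw m hh.continuous, ← hh.sum_muWord hD3 m, Real.dist_eq, Finset.sum_div,
    ← Finset.sum_sub_distrib]
  refine (Finset.abs_sum_le_sum_abs _ _).trans ?_
  rw [← one_mul ε, ← S.sum_muWord m, Finset.sum_mul]
  refine Finset.sum_le_sum fun w _ => ?_
  rw [mul_div_assoc, ← mul_sub, abs_mul, abs_of_pos (S.muWord_pos w)]
  refine mul_le_mul_of_nonneg_left ?_ (S.muWord_pos w).le
  have hi : ∀ i, |∫ x, h (S.Fw w x) ∂ν - h (S.Fw w (S.q i))| ≤ ε := by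
    intro i
    have h1 : ∫ x, h (S.Fw w x) ∂ν - h (S.Fw w (S.q i)) =
        ∫ x, (h (S.Fw w x) - h (S.Fw w (S.q i))) ∂ν := by
      have hc : Continuous fun x => h (S.Fw w x) := hh.continuous.comp (S.Fw_continuous w)
      rw [integral_sub (hc.integrable_of_hasCompactSupport (HasCompactSupport.of_compactSpace _))
        (integrable_const _)]
      simp
    rw [h1]
    simpa using norm_integral_le_of_norm_le_const (μ := ν) (C := ε)
      (f := fun x => h (S.Fw w x) - h (S.Fw w (S.q i))) (Eventually.of_forall fun x => hosc w x (S.q i))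
  have h0 := abs_le.1 (hi 0)
  have h1 := abs_le.1 (hi 1)
  have h2 := abs_le.1 (hi 2)
  rw [Fin.sum_univ_three, abs_le]
  constructor <;> linarith

/-- On each cell at x the tent is harmonic with boundary values 1, 0, 0 in some order, so its mean
there is 1/3. Afterwards the measure enters only through the combinatorial `mass`. -/
theorem integral_tent (hD3 : S.IsD3Symmetric) (hν : S.IsSelfSimilarMeasure ν) {m : ℕ} {x : K}
    (hx : x ∈ S.V m) : ∫ y, S.tent m x y ∂ν = S.mass m x := by
  obtain ⟨h1, h2, h3⟩ : S.IsTent m x (S.tent m x) :=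
    Classical.epsilon_spec (S.exists_isTent m x hx)
  rw [hν.integral_Fw m (continuous_of_comp_Fw fun w => (h1 w).continuous), mass, vsum]
  refine Finset.sum_congr rfl fun w _ => ?_
  have h4 := (h1 w).integral_eq hD3 hν
  simp only [Function.comp_apply] at h4
  rw [h4, mul_div_assoc', mul_div_right_comm, Finset.mul_sum]
  refine Finset.sum_congr rfl fun i _ => ?_
  split_ifs with h
  · rw [h, h2, mul_one]
  · rw [h3 _ (S.mem_V w i) h, mul_zero]

theorem renLaplacian_eq (hD3 : S.IsD3Symmetric) (hν : S.IsSelfSimilarMeasure ν) {m : ℕ} {x : K}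
    (hx : x ∈ S.V m) (f : K → ℝ) :
    S.renLaplacian ν m f x = (S.mass m x)⁻¹ * S.graphLaplacian m f x := by
  rw [renLaplacian, integral_tent hD3 hν hx]

end

end HarmonicPCF

end

/-! ### Corner cells: the eigenvalues of M_l and the derivatives at q_l. -/

noncomputable section

/-- Row l makes the matrix block triangular, and the remaining symmetric 2 × 2 block has
eigenvectors (1, 1) and (1, -1). -/
theorem Matrix.charpoly_of_corner (A : Matrix (Fin 3) (Fin 3) ℝ) (l : Fin 3) {a b : ℝ}
    (h0 : A l l = 1) (h1 : A l (l + 1) = 0) (h2 : A l (l - 1) = 0)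
    (h3 : A (l + 1) (l + 1) = a) (h4 : A (l + 1) (l - 1) = b)
    (h5 : A (l - 1) (l + 1) = b) (h6 : A (l - 1) (l - 1) = a) :
    A.charpoly = (Polynomial.X - Polynomial.C 1) * (Polynomial.X - Polynomial.C (a + b)) *
      (Polynomial.X - Polynomial.C (a - b)) := by
  have e1 : (-1 : Fin 3) = 2 := rfl
  have e2 : (1 + 1 : Fin 3) = 2 := rfl
  have e3 : (2 + 1 : Fin 3) = 0 := rfl
  have e4 : (2 - 1 : Fin 3) = 1 := rfl
  rw [Matrix.charpoly, Matrix.det_fin_three]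
  fin_cases l <;> simp [e1, e2, e3, e4] at h0 h1 h2 h3 h4 h5 h6 <;>
    simp [h0, h1, h2, h3, h4, h5, h6] <;> ring

theorem Multiset.erase_erase_sum (a b c : ℝ) :
    ((({a, b, c} : Multiset ℝ).erase a).erase b).sum = c := by
  simp

namespace HarmonicPCF

variable {K : Type*} [MetricSpace K] {N : ℕ} (S : HarmonicPCF K N)

theorem vsum_q (m : ℕ) (φ : (Fin m → Fin N) → Fin 3 → ℝ) (l : Fin 3) :
    S.vsum m φ (S.q l) = φ (fun _ => S.corner l) l := by
  classical
  have h1 : ∀ (w : Fin m → Fin N) (i : Fin 3), S.Fw w (S.q i) = S.q l ↔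
      w = (fun _ => S.corner l) ∧ i = l := by
    intro w i
    constructor
    · intro h
      exact ⟨(S.Fw_eq_q h).1, S.q_injective (S.Fw_eq_q h).2⟩
    · rintro ⟨rfl, rfl⟩
      rw [Fw_corner, FB_iterate_q]
  simp only [vsum, h1, ite_and]
  rw [Finset.sum_eq_single (fun _ => S.corner l)]
  · simp
  · intro w _ hw
    simp [hw]
  · simp

theorem graphLaplacian_q (m : ℕ) (f : K → ℝ) (l : Fin 3) : S.graphLaplacian m f (S.q l) =
    (S.r (S.corner l) ^ m)⁻¹ * lapAt (fun k => f ((S.FB l)^[m] (S.q k))) l := by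
  rw [graphLaplacian_eq, vsum_q]
  simp [rWord, Fw_corner]

theorem mass_q (m : ℕ) (l : Fin 3) : S.mass m (S.q l) = S.mu (S.corner l) ^ m / 3 := by
  rw [mass, vsum_q]
  simp [muWord]

theorem graphLaplacian_F (m : ℕ) (f : K → ℝ) (l : Fin N) {x : K} (hx : x ∉ S.V 0) :
    S.graphLaplacian (m + 1) f (S.F l x) =
      (S.r l)⁻¹ * S.graphLaplacian m (fun y => f (S.F l y)) x := by
  rw [graphLaplacian_eq, graphLaplacian_eq, vsum_F _ _ _ _ hx, mul_vsum]
  simp only [rWord_cons, mul_inv, mul_assoc, Fw_cons]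

theorem mass_F (m : ℕ) (l : Fin N) {x : K} (hx : x ∉ S.V 0) :
    S.mass (m + 1) (S.F l x) = S.mu l * S.mass m x := by
  rw [mass, mass, vsum_F _ _ _ _ hx, mul_vsum]
  simp only [muWord_cons, mul_div_assoc]

/-- The only m-cell at q_l has conductance r^{-m}, so the difference quotient is minus a graph
Laplacian. Rules for graph Laplacians thus become rules for normal derivatives. -/
theorem hasNormalDeriv_iff (f : K → ℝ) (l : Fin 3) (d : ℝ) : S.HasNormalDeriv f l d ↔
    Tendsto (fun m => -S.graphLaplacian m f (S.q l)) atTop (𝓝 d) := by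
  refine iff_of_eq (congrArg (fun s : ℕ → ℝ => Tendsto s atTop (𝓝 d)) (funext fun m => ?_))
  rw [graphLaplacian_q, lapAt_eq, Fin.sum_univ_three_cyclic _ l, FB_iterate_q]
  ring

/-- The difference of `f` across the corner cell of level `m` at `q_l`. -/
def cornerDiff (m : ℕ) (f : K → ℝ) (l : Fin 3) : ℝ :=
  f ((S.FB l)^[m] (S.q (l + 1))) - f ((S.FB l)^[m] (S.q (l - 1)))

theorem hasTransverseDeriv_iff (f : K → ℝ) (l : Fin 3) (d : ℝ) : S.HasTransverseDeriv f l d ↔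
    Tendsto (fun m => (S.lam l ^ m)⁻¹ * S.cornerDiff m f l) atTop (𝓝 d) := Iff.rfl

/-- A symmetry may flip the corner cells differently at different levels, so it controls corner
differences only up to sign. For a vanishing derivative the sign is irrelevant. -/
theorem hasTransverseDeriv_zero_iff (f : K → ℝ) (l : Fin 3) : S.HasTransverseDeriv f l 0 ↔
    Tendsto (fun m => (|S.lam l| ^ m)⁻¹ * |S.cornerDiff m f l|) atTop (𝓝 0) := by
  rw [hasTransverseDeriv_iff, tendsto_zero_iff_abs_tendsto_zero]
  simp only [Function.comp_def, abs_mul, abs_inv, abs_pow]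

theorem M_apply (l i k : Fin 3) :
    S.M l i k = S.harmonicExt (Pi.single k 1) (S.FB l (S.q i)) := rfl

variable {S}

theorem IsSymmetry.abs_cornerDiff {g : K ≃ₜ K} (hg : S.IsSymmetry g) {l k : Fin 3}
    (hlk : g (S.q l) = S.q k) (m : ℕ) (f : K → ℝ) :
    |S.cornerDiff m (fun x => f (g x)) l| = |S.cornerDiff m f k| := by
  obtain ⟨τ, hτ, h⟩ := hg.exists_corner_perm hlk m
  simp only [cornerDiff, h]
  have h1 := (Fin.eq_or_three k (τ (l + 1))).resolve_left fun e =>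
    Fin.add_one_ne_self_three l (τ.injective (e.trans hτ.symm))
  have h2 := (Fin.eq_or_three k (τ (l - 1))).resolve_left fun e =>
    Fin.sub_one_ne_self_three l (τ.injective (e.trans hτ.symm))
  have h3 : τ (l + 1) ≠ τ (l - 1) := τ.injective.ne (Fin.add_one_ne_sub_one_three l)
  rcases h1 with h1 | h1 <;> rcases h2 with h2 | h2
  · exact absurd (h1.trans h2.symm) h3
  · rw [h1, h2]
  · rw [h1, h2, abs_sub_comm]
  · exact absurd (h1.trans h2.symm) h3

theorem IsSymmetry.lapAt_corner {g : K ≃ₜ K} (hg : S.IsSymmetry g) {l k : Fin 3}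
    (hlk : g (S.q l) = S.q k) (m : ℕ) (f : K → ℝ) :
    lapAt (fun i => f (g ((S.FB l)^[m] (S.q i)))) l =
      lapAt (fun i => f ((S.FB k)^[m] (S.q i))) k := by
  obtain ⟨τ, hτ, h⟩ := hg.exists_corner_perm hlk m
  simp only [h, ← hτ]
  exact lapAt_perm (fun i => f ((S.FB (τ l))^[m] (S.q i))) τ l

section
variable [CompactSpace K]

theorem IsHarmonic.graphLaplacian_eq_zero {h : K → ℝ} (hh : S.IsHarmonic h) {m : ℕ} {x : K}
    (hx : x ∈ S.V m \ S.V 0) : S.graphLaplacian m h x = 0 := by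
  classical
  have h1 := hh.form_eq (Pi.single x 1) m
  have h2 : ∀ i, S.q i ≠ x := fun i e => hx.2 (e ▸ S.q_mem_V_zero i)
  rw [form_eq_neg_sum, form_zero] at h1
  simpa [form0, h2, Pi.single_apply, S.mem_vertices.2 hx.1] using h1

theorem IsHarmonic.graphLaplacian_q {h : K → ℝ} (hh : S.IsHarmonic h) (m : ℕ) (l : Fin 3) :
    S.graphLaplacian m h (S.q l) = lapAt (fun i => h (S.q i)) l := by
  classical
  have h1 := hh.form_eq (Pi.single (S.q l) 1) m
  rw [form_eq_neg_sum, form_zero, form0_eq_neg_sum_lapAt, neg_inj] at h1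
  simpa [Pi.single_apply, S.mem_vertices.2 (S.q_mem_V m l), S.q_injective.eq_iff] using h1

theorem IsHarmonic.apply_FB_iterate {h : K → ℝ} (hh : S.IsHarmonic h) (l i : Fin 3) (m : ℕ) :
    h ((S.FB l)^[m] (S.q i)) = (S.M l ^ m).mulVec (fun k => h (S.q k)) i := by
  induction m generalizing h with
  | zero => simp
  | succ m ih =>
    rw [Function.iterate_succ_apply', pow_succ, ← Matrix.mulVec_mulVec]
    refine (ih (hh.comp_F (S.corner l))).trans (congrArg (fun u => (S.M l ^ m).mulVec u i) ?_)
    funext k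
    exact hh.eq_sum _

variable (hM : ∀ l, (S.M l).det ≠ 0)
include hM

theorem IsHarmonic.q_eq_zero_of_iterate {h : K → ℝ} (hh : S.IsHarmonic h) {l : Fin 3} {m : ℕ}
    (h0 : ∀ i, h ((S.FB l)^[m] (S.q i)) = 0) (i : Fin 3) : h (S.q i) = 0 := by
  have h1 : (S.M l ^ m).mulVec (fun k => h (S.q k)) = 0 := funext fun i => by
    rw [← hh.apply_FB_iterate, h0, Pi.zero_apply]
  have h2 : (S.M l ^ m).det ≠ 0 := by
    rw [Matrix.det_pow]
    exact pow_ne_zero _ (hM l)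
  exact congrFun (Matrix.eq_zero_of_mulVec_eq_zero h2 h1) i

/-- The reflection at `q_l` swaps the two other vertices of every corner cell at `q_l`. -/
theorem exists_reflection (hD3 : S.IsD3Symmetric) (l : Fin 3) : ∃ g : K ≃ₜ K, S.IsSymmetry g ∧
    g (S.q l) = S.q l ∧ ∀ m, g ((S.FB l)^[m] (S.q (l + 1))) = (S.FB l)^[m] (S.q (l - 1)) ∧
      g ((S.FB l)^[m] (S.q (l - 1))) = (S.FB l)^[m] (S.q (l + 1)) := by
  obtain ⟨g, hgq, hg⟩ := hD3 (Equiv.swap (l + 1) (l - 1))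
  have hl : g (S.q l) = S.q l := by
    rw [hgq, Equiv.swap_apply_of_ne_of_ne (Fin.add_one_ne_self_three l).symm
      (Fin.sub_one_ne_self_three l).symm]
  refine ⟨g, hg, hl, fun m => ?_⟩
  obtain ⟨τ, hτ, h⟩ := hg.exists_corner_perm hl m
  rw [h, h]
  have h1 := (Fin.eq_or_three l (τ (l + 1))).resolve_left fun e =>
    Fin.add_one_ne_self_three l (τ.injective (e.trans hτ.symm))
  have h2 := (Fin.eq_or_three l (τ (l - 1))).resolve_left fun e =>
    Fin.sub_one_ne_self_three l (τ.injective (e.trans hτ.symm))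
  have h3 : τ (l + 1) ≠ τ (l - 1) := τ.injective.ne (Fin.add_one_ne_sub_one_three l)
  rcases h1 with h1 | h1 <;> rcases h2 with h2 | h2
  · exact absurd (h1.trans h2.symm) h3
  · exfalso
    -- If the vertices of the m-th corner cell were fixed, the harmonic function that is
    -- antisymmetric under the reflection would vanish at all of them, against the invertibility of
    -- M_l^m.
    set u : Fin 3 → ℝ := Pi.single (l + 1) 1 - Pi.single (l - 1) 1 with hu
    have hul : u l = 0 := by
      simp [hu, (Fin.add_one_ne_self_three l).symm, (Fin.sub_one_ne_self_three l).symm]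
    have hu1 : u (l + 1) = 1 := by simp [hu, Fin.add_one_ne_sub_one_three l]
    have hu2 : u (l - 1) = -1 := by simp [hu, (Fin.add_one_ne_sub_one_three l).symm]
    have hh := S.isHarmonic_harmonicExt u
    have hanti : (fun x => S.harmonicExt u (g x)) = fun x => -1 * S.harmonicExt u x := by
      refine (hh.comp_symmetry hg).ext (hh.smul (-1)) fun i => ?_
      rw [hgq, harmonicExt_q, harmonicExt_q]
      rcases Fin.eq_or_three l i with rfl | rfl | rfl
      · rw [Equiv.swap_apply_of_ne_of_ne (Fin.add_one_ne_self_three _).symm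
          (Fin.sub_one_ne_self_three _).symm, hul, mul_zero]
      · rw [Equiv.swap_apply_left, hu1, hu2, mul_one]
      · rw [Equiv.swap_apply_right, hu1, hu2]
        norm_num
    have h4 : ∀ i, S.harmonicExt u ((S.FB l)^[m] (S.q i)) = 0 := by
      intro i
      have h5 := congrFun hanti ((S.FB l)^[m] (S.q i))
      simp only [h] at h5
      rcases Fin.eq_or_three l i with rfl | rfl | rfl
      · rw [FB_iterate_q, harmonicExt_q, hul]
      · rw [h1] at h5
        linarith
      · rw [h2] at h5
        linarith
    have h6 := hh.q_eq_zero_of_iterate hM h4 (l + 1)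
    rw [harmonicExt_q, hu1] at h6
    exact one_ne_zero h6
  · rw [h1, h2]
    exact ⟨rfl, rfl⟩
  · exact absurd (h1.trans h2.symm) h3

/-- The reflection symmetrizes M_l, so its eigenvalues are 1, a + b = r and a - b. The last one is
what `lam` retains and is the factor on antisymmetric boundary values; if it were 0, the
antisymmetric vector would lie in the kernel. -/
theorem lam_ne_zero_and_cornerDiff (hD3 : S.IsD3Symmetric) (l : Fin 3) : S.lam l ≠ 0 ∧
    ∀ h : K → ℝ, S.IsHarmonic h → S.cornerDiff 1 h l = S.lam l * S.cornerDiff 0 h l := by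
  obtain ⟨g, hg, hgl, hgm⟩ := exists_reflection hM hD3 l
  have hg0 := hgm 0
  have hg1 := hgm 1
  simp only [Function.iterate_zero_apply, Function.iterate_one] at hg0 hg1
  have n1 := Fin.add_one_ne_self_three l
  have n2 := Fin.sub_one_ne_self_three l
  have n3 := Fin.add_one_ne_sub_one_three l
  have hH := fun k => S.isHarmonic_harmonicExt (Pi.single k 1)
  have e1 : S.harmonicExt (Pi.single (l - 1) 1) =
      fun x => S.harmonicExt (Pi.single (l + 1) 1) (g x) := by
    refine (hH _).ext ((hH _).comp_symmetry hg) fun i => ?_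
    rcases Fin.eq_or_three l i with h | h | h
    · rw [h, hgl, harmonicExt_q, harmonicExt_q]
      simp [n1.symm, n2.symm]
    · rw [h, hg0.1, harmonicExt_q, harmonicExt_q]
      simp [n3, n3.symm]
    · rw [h, hg0.2, harmonicExt_q, harmonicExt_q]
      simp
  have e2 : S.harmonicExt (Pi.single l 1) = fun x => S.harmonicExt (Pi.single l 1) (g x) := by
    refine (hH _).ext ((hH _).comp_symmetry hg) fun i => ?_
    rcases Fin.eq_or_three l i with h | h | h
    · rw [h, hgl]
    · rw [h, hg0.1, harmonicExt_q, harmonicExt_q]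
      simp [n1, n2]
    · rw [h, hg0.2, harmonicExt_q, harmonicExt_q]
      simp [n1, n2]
  have hrow : ∀ k, S.M l l k = (Pi.single k 1 : Fin 3 → ℝ) l := fun k => by
    rw [M_apply, FB_q, harmonicExt_q]
  set a := S.M l (l + 1) (l + 1) with ha
  set b := S.M l (l + 1) (l - 1) with hb
  have h5 : S.M l (l - 1) (l + 1) = b := by
    rw [hb, M_apply, M_apply, e1, ← hg1.1]
  have h6 : S.M l (l - 1) (l - 1) = a := by
    rw [ha, M_apply, M_apply, e1, ← hg1.2]
  have h7 : S.M l (l - 1) l = S.M l (l + 1) l := by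
    rw [M_apply, M_apply, ← hg1.1]
    exact (congrFun e2 _).symm
  -- The graph Laplacian at q_l of the harmonic function with boundary value 1 at q_{l+1} is 1 at
  -- level 0 and r⁻¹(a + b) at level 1, and it does not depend on the level.
  have hr : a + b = S.r (S.corner l) := by
    have h8 := (hH (l + 1)).graphLaplacian_q 1 l
    rw [HarmonicPCF.graphLaplacian_q, lapAt_eq, lapAt_eq, Fin.sum_univ_three_cyclic _ l,
      Fin.sum_univ_three_cyclic _ l] at h8
    simp only [Function.iterate_one, FB_q, harmonicExt_q, ← M_apply, h5, ← ha] at h8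
    simp [n1.symm, n3.symm] at h8
    rw [inv_mul_eq_one₀ (S.r_pos _).ne'] at h8
    exact h8.symm
  have hlam : S.lam l = a - b := by
    rw [lam, Matrix.charpoly_of_corner (S.M l) l (a := a) (b := b) (by simp [hrow])
      (by simp [hrow, n1.symm]) (by simp [hrow, n2.symm]) rfl rfl h5 h6, ← hr]
    rw [Polynomial.roots_mul, Polynomial.roots_mul, Polynomial.roots_X_sub_C,
      Polynomial.roots_X_sub_C, Polynomial.roots_X_sub_C]
    · exact Multiset.erase_erase_sum 1 (a + b) (a - b)
    · exact mul_ne_zero (Polynomial.X_sub_C_ne_zero _) (Polynomial.X_sub_C_ne_zero _)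
    · exact mul_ne_zero (mul_ne_zero (Polynomial.X_sub_C_ne_zero _)
        (Polynomial.X_sub_C_ne_zero _)) (Polynomial.X_sub_C_ne_zero _)
  have hval : ∀ (h : K → ℝ), S.IsHarmonic h → ∀ i, h (S.FB l (S.q i)) =
      S.M l i l * h (S.q l) + S.M l i (l + 1) * h (S.q (l + 1)) +
        S.M l i (l - 1) * h (S.q (l - 1)) := fun h hh i => by
    rw [hh.eq_sum, Fin.sum_univ_three_cyclic _ l]
    rfl
  have hdiff : ∀ h : K → ℝ, S.IsHarmonic h →
      S.cornerDiff 1 h l = S.lam l * S.cornerDiff 0 h l := by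
    intro h hh
    simp only [cornerDiff, Function.iterate_one, Function.iterate_zero_apply, hval h hh, h5, h6,
      h7, hlam]
    ring
  refine ⟨fun h0 => ?_, hdiff⟩
  have h9 := (hH (l + 1)).lin (hH (l - 1)) (-1)
  have h10 := h9.q_eq_zero_of_iterate hM (l := l) (m := 1) (fun i => ?_) (l + 1)
  · simp only [harmonicExt_q] at h10
    simp [n3] at h10
  · rw [hlam] at h0
    simp only [Function.iterate_one, ← M_apply]
    rcases Fin.eq_or_three l i with h | h | h
    · rw [h, hrow, hrow]
      simp [n1.symm, n2.symm]
    · rw [h]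
      linarith
    · rw [h, h5, h6]
      linarith

theorem IsHarmonic.cornerDiff_eq (hD3 : S.IsD3Symmetric) {h : K → ℝ} (hh : S.IsHarmonic h)
    (l : Fin 3) (m : ℕ) : S.cornerDiff m h l = S.lam l ^ m * S.cornerDiff 0 h l := by
  induction m generalizing h with
  | zero => simp
  | succ m ih =>
    have h1 := ih (hh.comp_F (S.corner l))
    have h2 := (lam_ne_zero_and_cornerDiff hM hD3 l).2 h hh
    rw [pow_succ, mul_assoc, ← h2]
    simp only [cornerDiff, Function.iterate_succ_apply'] at h1 ⊢
    exact h1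

/-- Compares the corner differences at levels 0 and 1 of one harmonic function and of its pullback
by the symmetry. -/
theorem abs_lam_eq (hD3 : S.IsD3Symmetric) {g : K ≃ₜ K} (hg : S.IsSymmetry g) {l k : Fin 3}
    (hlk : g (S.q l) = S.q k) : |S.lam l| = |S.lam k| := by
  have hh := S.isHarmonic_harmonicExt (Pi.single (k + 1) 1)
  have h1 := hg.abs_cornerDiff hlk 1 (S.harmonicExt (Pi.single (k + 1) 1))
  have h0 := hg.abs_cornerDiff hlk 0 (S.harmonicExt (Pi.single (k + 1) 1))
  rw [(hh.comp_symmetry hg).cornerDiff_eq hM hD3, hh.cornerDiff_eq hM hD3, abs_mul, abs_mul, h0,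
    pow_one, pow_one] at h1
  have h2 : S.cornerDiff 0 (S.harmonicExt (Pi.single (k + 1) 1)) k = 1 := by
    simp [cornerDiff, harmonicExt_q, (Fin.add_one_ne_sub_one_three k).symm]
  simpa [h2] using h1

/-- A harmonic function is determined by its value and its derivatives at a boundary point. -/
theorem IsHarmonic.eq_zero_of_jet (hD3 : S.IsD3Symmetric) {h : K → ℝ} (hh : S.IsHarmonic h)
    {l : Fin 3} (h0 : h (S.q l) = 0) (h1 : S.HasNormalDeriv h l 0)
    (h2 : S.HasTransverseDeriv h l 0) : h = fun _ => 0 := by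
  rw [hasNormalDeriv_iff] at h1
  simp only [hh.graphLaplacian_q] at h1
  have h3 := tendsto_nhds_unique h1 tendsto_const_nhds
  rw [lapAt_eq, Fin.sum_univ_three_cyclic _ l, h0] at h3
  rw [hasTransverseDeriv_iff] at h2
  have hl := (lam_ne_zero_and_cornerDiff hM hD3 l).1
  have h5 : (fun m => (S.lam l ^ m)⁻¹ * S.cornerDiff m h l) = fun _ => S.cornerDiff 0 h l :=
    funext fun m => by
      rw [hh.cornerDiff_eq hM hD3 l m, inv_mul_cancel_left₀ (pow_ne_zero _ hl)]
  rw [h5] at h2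
  have h4 := tendsto_nhds_unique h2 tendsto_const_nhds
  simp only [cornerDiff, Function.iterate_zero_apply] at h4
  refine hh.eq_zero fun i => ?_
  rcases Fin.eq_or_three l i with h | h | h <;> rw [h] <;> linarith

end

end HarmonicPCF

end

/-! ### The Laplacian: linearity, pullbacks, uniqueness. -/

noncomputable section

namespace HarmonicPCF

variable {K : Type*} [MetricSpace K] {N : ℕ} {S : HarmonicPCF K N}

variable (S) in
theorem V_mono : Monotone S.V := monotone_nat_of_le_succ S.V_subset_succ

theorem HasNormalDeriv.lin {f f' : K → ℝ} {l : Fin 3} {d d' : ℝ} (h : S.HasNormalDeriv f l d)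
    (h' : S.HasNormalDeriv f' l d') (c : ℝ) :
    S.HasNormalDeriv (fun x => f x + c * f' x) l (d + c * d') := by
  rw [hasNormalDeriv_iff] at *
  refine (h.add (h'.const_mul c)).congr fun m => ?_
  rw [graphLaplacian_lin]
  ring

theorem HasTransverseDeriv.lin {f f' : K → ℝ} {l : Fin 3} {d d' : ℝ}
    (h : S.HasTransverseDeriv f l d) (h' : S.HasTransverseDeriv f' l d') (c : ℝ) :
    S.HasTransverseDeriv (fun x => f x + c * f' x) l (d + c * d') := by
  rw [hasTransverseDeriv_iff] at *
  refine (h.add (h'.const_mul c)).congr fun m => ?_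
  simp only [cornerDiff]
  ring

theorem HasNormalDeriv.comp_symmetry {f : K → ℝ} {l k : Fin 3} {d : ℝ}
    (h : S.HasNormalDeriv f k d) {g : K ≃ₜ K} (hg : S.IsSymmetry g) (hlk : g (S.q l) = S.q k) :
    S.HasNormalDeriv (fun x => f (g x)) l d := by
  rw [hasNormalDeriv_iff] at *
  simpa only [hg.graphLaplacian_comp, hlk] using h

theorem HasNormalDeriv.comp_FB {f : K → ℝ} {l : Fin 3} (h : S.HasNormalDeriv f l 0) :
    S.HasNormalDeriv (fun x => f (S.FB l x)) l 0 := by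
  rw [hasNormalDeriv_iff] at *
  have h1 := ((tendsto_add_atTop_iff_nat 1).2 h).const_mul (S.r (S.corner l))
  rw [mul_zero] at h1
  refine h1.congr fun m => ?_
  rw [graphLaplacian_q, graphLaplacian_q, pow_succ]
  simp only [Function.iterate_succ_apply']
  have := (S.r_pos (S.corner l)).ne'
  field_simp

section Symmetric

variable [CompactSpace K]

theorem HasTransverseDeriv.comp_symmetry (hM : ∀ l, (S.M l).det ≠ 0) (hD3 : S.IsD3Symmetric)
    {f : K → ℝ} {l k : Fin 3} (h : S.HasTransverseDeriv f k 0) {g : K ≃ₜ K}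
    (hg : S.IsSymmetry g) (hlk : g (S.q l) = S.q k) :
    S.HasTransverseDeriv (fun x => f (g x)) l 0 := by
  rw [hasTransverseDeriv_zero_iff] at *
  simpa only [hg.abs_cornerDiff hlk, abs_lam_eq hM hD3 hg hlk] using h

theorem HasTransverseDeriv.comp_FB (hM : ∀ l, (S.M l).det ≠ 0) (hD3 : S.IsD3Symmetric)
    {f : K → ℝ} {l : Fin 3} (h : S.HasTransverseDeriv f l 0) :
    S.HasTransverseDeriv (fun x => f (S.FB l x)) l 0 := by
  rw [hasTransverseDeriv_iff] at *
  have h1 := ((tendsto_add_atTop_iff_nat 1).2 h).const_mul (S.lam l)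
  rw [mul_zero] at h1
  refine h1.congr fun m => ?_
  rw [pow_succ]
  simp only [cornerDiff, Function.iterate_succ_apply']
  have := (lam_ne_zero_and_cornerDiff hM hD3 l).1
  field_simp

end Symmetric

variable [MeasurableSpace K] {ν : Measure K}

theorem renLaplacian_lin (m : ℕ) (f g : K → ℝ) (c : ℝ) (x : K) :
    S.renLaplacian ν m (fun y => f y + c * g y) x =
      S.renLaplacian ν m f x + c * S.renLaplacian ν m g x := by
  simp only [renLaplacian, graphLaplacian_lin]
  ring

theorem HasLaplacian.tendsto {f g : K → ℝ} (h : S.HasLaplacian ν f g) {n : ℕ} {x : K}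
    (hx : x ∈ S.V n \ S.V 0) :
    Tendsto (fun m => S.renLaplacian ν m f x) atTop (𝓝 (g x)) := by
  rw [Metric.tendsto_atTop]
  intro ε hε
  obtain ⟨m₀, hm⟩ := h.2.2 ε hε
  refine ⟨max m₀ n, fun m hmn => ?_⟩
  rw [Real.dist_eq]
  exact hm m (le_of_max_le_left hmn) x ⟨S.V_mono (le_of_max_le_right hmn) hx.1, hx.2⟩

theorem HasLaplacian.lin {f g f' g' : K → ℝ} (h : S.HasLaplacian ν f g)
    (h' : S.HasLaplacian ν f' g') (c : ℝ) :
    S.HasLaplacian ν (fun x => f x + c * f' x) (fun x => g x + c * g' x) := by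
  refine ⟨h.1.add (continuous_const.mul h'.1), h.2.1.add (continuous_const.mul h'.2.1),
    fun ε hε => ?_⟩
  obtain ⟨m₁, h1⟩ := h.2.2 (ε / 2) (by positivity)
  obtain ⟨m₂, h2⟩ := h'.2.2 (ε / (2 * (|c| + 1))) (by positivity)
  refine ⟨max m₁ m₂, fun m hm x hx => ?_⟩
  have h3 := h1 m (le_of_max_le_left hm) x hx
  have h4 := h2 m (le_of_max_le_right hm) x hx
  rw [renLaplacian_lin]
  calc |S.renLaplacian ν m f x + c * S.renLaplacian ν m f' x - (g x + c * g' x)|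
      = |(S.renLaplacian ν m f x - g x) + c * (S.renLaplacian ν m f' x - g' x)| := by
        congr 1
        ring
    _ ≤ |S.renLaplacian ν m f x - g x| + |c| * |S.renLaplacian ν m f' x - g' x| := by
        rw [← abs_mul]
        exact abs_add_le _ _
    _ < ε / 2 + ε / 2 := by
        refine add_lt_add_of_lt_of_le h3 ?_
        calc |c| * |S.renLaplacian ν m f' x - g' x|
            ≤ (|c| + 1) * (ε / (2 * (|c| + 1))) := by
              gcongr
              linarith
          _ = ε / 2 := by
              field_simp
    _ = ε := add_halves ε

theorem hasLaplacian_zero : S.HasLaplacian ν (fun _ => 0) fun _ => 0 :=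
  ⟨continuous_const, continuous_const, fun ε hε => ⟨0, fun m _ x _ => by
    simpa [renLaplacian, graphLaplacian] using hε⟩⟩

theorem HasLaplacian.smul {f g : K → ℝ} (h : S.HasLaplacian ν f g) (c : ℝ) :
    S.HasLaplacian ν (fun x => c * f x) fun x => c * g x := by
  simpa using hasLaplacian_zero.lin h c

theorem HasLaplacian.sum {ι : Type*} (s : Finset ι) {f g : ι → K → ℝ}
    (h : ∀ i ∈ s, S.HasLaplacian ν (f i) (g i)) :
    S.HasLaplacian ν (fun x => ∑ i ∈ s, f i x) fun x => ∑ i ∈ s, g i x := by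
  classical
  induction s using Finset.induction_on with
  | empty => simpa using hasLaplacian_zero
  | insert a s ha ih =>
    simp only [Finset.sum_insert ha]
    simpa using (h a (Finset.mem_insert_self a s)).lin
      (ih fun i hi => h i (Finset.mem_insert_of_mem hi)) 1

variable [CompactSpace K]

theorem HasLaplacian.unique {f g g' : K → ℝ} (h : S.HasLaplacian ν f g)
    (h' : S.HasLaplacian ν f g') : g = g' :=
  S.eq_of_eqOn_V h.2.1 h'.2.1 fun _ _ hx => tendsto_nhds_unique (h.tendsto hx) (h'.tendsto hx)

variable [BorelSpace K] (hD3 : S.IsD3Symmetric) (hν : S.IsSelfSimilarMeasure ν)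
include hD3 hν

theorem HasLaplacian.comp_symmetry {f g : K → ℝ} (h : S.HasLaplacian ν f g) {t : K ≃ₜ K}
    (ht : S.IsSymmetry t) : S.HasLaplacian ν (fun x => f (t x)) fun x => g (t x) := by
  refine ⟨h.1.comp t.continuous, h.2.1.comp t.continuous, fun ε hε => ?_⟩
  obtain ⟨m₀, hm⟩ := h.2.2 ε hε
  refine ⟨m₀, fun m hmm x hx => ?_⟩
  have hx' : t x ∈ S.V m \ S.V 0 := ⟨ht.mem_V_iff.2 hx.1, fun h => hx.2 (ht.mem_V_iff.1 h)⟩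
  have := hm m hmm (t x) hx'
  rwa [renLaplacian_eq hD3 hν hx'.1, ht.mass_comp, ← ht.graphLaplacian_comp,
    ← renLaplacian_eq hD3 hν hx.1] at this

/-- Under F_l conductances scale by r_l⁻¹ and masses by μ_l, hence renormalized Laplacians by (r_l
μ_l)⁻¹. -/
theorem renLaplacian_F {ρ : ℝ} (hρ : ∀ l, S.r l * S.mu l = ρ) (m : ℕ) (f : K → ℝ) (l : Fin N)
    {x : K} (hx : x ∈ S.V m \ S.V 0) : ρ * S.renLaplacian ν (m + 1) f (S.F l x) =
      S.renLaplacian ν m (fun y => f (S.F l y)) x := by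
  rw [renLaplacian_eq hD3 hν (S.F_mem_V_succ l hx.1), renLaplacian_eq hD3 hν hx.1,
    S.mass_F _ _ hx.2, S.graphLaplacian_F _ _ _ hx.2, ← hρ l]
  have h1 := (S.r_pos l).ne'
  have h2 := (S.mu_pos l).ne'
  have h3 := (S.mass_pos hx.1).ne'
  field_simp

theorem HasLaplacian.comp_F {ρ : ℝ} (hρ : ∀ l, S.r l * S.mu l = ρ) {f g : K → ℝ}
    (h : S.HasLaplacian ν f g) (l : Fin N) :
    S.HasLaplacian ν (fun x => f (S.F l x)) fun x => ρ * g (S.F l x) := by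
  have hρ0 : 0 < ρ := hρ l ▸ mul_pos (S.r_pos l) (S.mu_pos l)
  refine ⟨h.1.comp (S.F_continuous l), continuous_const.mul (h.2.1.comp (S.F_continuous l)),
    fun ε hε => ?_⟩
  obtain ⟨m₀, hm⟩ := h.2.2 (ε / ρ) (by positivity)
  refine ⟨m₀, fun m hmm x hx => ?_⟩
  have := hm (m + 1) (by omega) (S.F l x) ⟨S.F_mem_V_succ l hx.1, S.F_notMem_V_zero l hx.2⟩
  rw [← renLaplacian_F hD3 hν hρ m f l hx, ← mul_sub, abs_mul, abs_of_pos hρ0]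
  rwa [lt_div_iff₀' hρ0] at this

theorem IsHarmonic.hasLaplacian {h : K → ℝ} (hh : S.IsHarmonic h) :
    S.HasLaplacian ν h fun _ => 0 := by
  refine ⟨hh.continuous, continuous_const, fun ε hε => ⟨0, fun m _ x hx => ?_⟩⟩
  rw [renLaplacian_eq hD3 hν hx.1, hh.graphLaplacian_eq_zero hx]
  simpa using hε

theorem graphLaplacian_eq_mass_mul {m : ℕ} {x : K} (hx : x ∈ S.V m) (f : K → ℝ) :
    S.graphLaplacian m f x = S.mass m x * S.renLaplacian ν m f x := by
  rw [renLaplacian_eq hD3 hν hx, mul_inv_cancel_left₀ (S.mass_pos hx).ne']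

/-- By summation by parts the energy is a mass-weighted sum of -f times its renormalized Laplacian,
without boundary terms. As f is bounded and the masses add up to 1, it tends to 0 with the level;
since energies increase with the level, all of them vanish. -/
theorem HasLaplacian.eq_zero {f : K → ℝ} (h : S.HasLaplacian ν f fun _ => 0)
    (h0 : ∀ i, f (S.q i) = 0) : f = fun _ => 0 := by
  obtain ⟨C, hC⟩ : ∃ C, ∀ x, |f x| ≤ C := by
    obtain ⟨C, hC⟩ := (isCompact_range h.1.abs).bddAbove
    exact ⟨C, fun x => hC (mem_range_self x)⟩
  have hC0 : 0 ≤ C := (abs_nonneg _).trans (hC (S.q 0))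
  have key : ∀ n, S.form n f f = 0 := by
    intro n
    refine le_antisymm (le_of_forall_pos_le_add fun δ hδ => ?_) (S.form_self_nonneg n f)
    obtain ⟨m₀, hm⟩ := h.2.2 (δ / (C + 1)) (by positivity)
    rw [zero_add]
    refine (S.form_mono f (le_max_left n m₀)).trans ?_
    set m := max n m₀ with hmdef
    change S.form m f f ≤ δ
    rw [form_eq_neg_sum, ← Finset.sum_neg_distrib]
    have h1 : ∀ x ∈ S.vertices m, -(f x * S.graphLaplacian m f x) ≤ S.mass m x * δ := by
      intro x hx
      rw [mem_vertices] at hx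
      have hmass := S.mass_pos hx
      by_cases hx0 : x ∈ S.V 0
      · obtain ⟨i, rfl⟩ := S.mem_V_zero.1 hx0
        rw [h0]
        simp only [zero_mul, neg_zero]
        positivity
      · have h2 := hm m (le_max_right _ _) x ⟨hx, hx0⟩
        rw [sub_zero] at h2
        rw [graphLaplacian_eq_mass_mul hD3 hν hx]
        calc -(f x * (S.mass m x * S.renLaplacian ν m f x))
            ≤ |f x * (S.mass m x * S.renLaplacian ν m f x)| := neg_le_abs _
          _ = S.mass m x * (|f x| * |S.renLaplacian ν m f x|) := by
            rw [abs_mul, abs_mul, abs_of_pos hmass]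
            ring
          _ ≤ S.mass m x * (C * (δ / (C + 1))) := by
            gcongr
            exact hC x
          _ ≤ S.mass m x * δ := by
            gcongr
            rw [mul_div_assoc', div_le_iff₀ (by positivity)]
            nlinarith
    refine (Finset.sum_le_sum h1).trans ?_
    rw [← Finset.sum_mul, sum_mass, one_mul]
  exact S.eq_of_eqOn_V h.1 continuous_const fun m x hx =>
    eq_zero_of_form_self_eq_zero (key m) h0 hx.1

theorem HasLaplacian.isHarmonic {f : K → ℝ} (h : S.HasLaplacian ν f fun _ => 0) :
    S.IsHarmonic f := by
  have hh := S.isHarmonic_harmonicExt fun i => f (S.q i)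
  have h1 : S.HasLaplacian ν (fun x => f x + -1 * S.harmonicExt (fun i => f (S.q i)) x)
      fun _ => 0 := by
    simpa using h.lin (hh.hasLaplacian hD3 hν) (-1)
  have h2 := h1.eq_zero hD3 hν fun i => by
    rw [harmonicExt_q]
    ring
  have h3 : f = S.harmonicExt fun i => f (S.q i) := funext fun x => by
    linarith [congrFun h2 x]
  rw [h3]
  exact hh

theorem eqOn_V_of_renLaplacian_eq {m : ℕ} {f g : K → ℝ} (h0 : ∀ i, f (S.q i) = g (S.q i))
    (h : ∀ x ∈ S.V m \ S.V 0, S.renLaplacian ν m f x = S.renLaplacian ν m g x) :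
    EqOn f g (S.V m) := by
  have h1 : S.form m (fun x => f x + -1 * g x) (fun x => f x + -1 * g x) = 0 := by
    rw [form_eq_neg_sum, neg_eq_zero]
    refine Finset.sum_eq_zero fun x hx => ?_
    rw [mem_vertices] at hx
    by_cases hx0 : x ∈ S.V 0
    · obtain ⟨i, rfl⟩ := S.mem_V_zero.1 hx0
      rw [h0]
      ring
    · rw [graphLaplacian_eq_mass_mul hD3 hν hx, renLaplacian_lin, h x ⟨hx, hx0⟩]
      ring
  intro x hx
  have := eq_zero_of_form_self_eq_zero h1 (fun i => by rw [h0]; ring) hx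
  linarith

end HarmonicPCF

end

/-! ### Jets at a boundary point and the monomials. -/

noncomputable section

namespace HarmonicPCF

variable {K : Type*} [MetricSpace K] {N : ℕ} (S : HarmonicPCF K N) [MeasurableSpace K]
  (ν : Measure K)

/-- `G i` is the `i`-th iterated Laplacian of the multiharmonic function `G 0`. -/
structure IsTower (G : ℕ → K → ℝ) : Prop where
  lap : ∀ i, S.HasLaplacian ν (G i) (G (i + 1))
  fin : ∃ n, ∀ i ≥ n, G i = fun _ => 0

/-- A tower whose normal and transverse derivatives at `q_l` vanish, with prescribed values. -/
structure IsJet (l : Fin 3) (a : ℕ → ℝ) (G : ℕ → K → ℝ) : Prop extends S.IsTower ν G where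
  value : ∀ i, G i (S.q l) = a i
  normal : ∀ i, S.HasNormalDeriv (G i) l 0
  trans : ∀ i, S.HasTransverseDeriv (G i) l 0

variable {S ν}

theorem IsTower.sum {ι : Type*} (s : Finset ι) {G : ι → ℕ → K → ℝ} (c : ι → ℝ)
    (h : ∀ p ∈ s, S.IsTower ν (G p)) : S.IsTower ν fun i x => ∑ p ∈ s, c p * G p i x := by
  refine ⟨fun i => HasLaplacian.sum s fun p hp => ((h p hp).lap i).smul (c p), ?_⟩
  choose! n hn using fun p hp => (h p hp).fin
  refine ⟨s.sup n, fun i hi => funext fun x => Finset.sum_eq_zero fun p hp => ?_⟩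
  rw [hn p hp i ((Finset.le_sup hp).trans hi), mul_zero]

theorem IsTower.lin {G G' : ℕ → K → ℝ} (h : S.IsTower ν G) (h' : S.IsTower ν G') (c : ℝ) :
    S.IsTower ν fun i x => G i x + c * G' i x := by
  refine ⟨fun i => (h.lap i).lin (h'.lap i) c, ?_⟩
  obtain ⟨n, hn⟩ := h.fin
  obtain ⟨n', hn'⟩ := h'.fin
  refine ⟨max n n', fun i hi => ?_⟩
  rw [hn i (le_of_max_le_left hi), hn' i (le_of_max_le_right hi)]
  simp

theorem IsTower.shift {G : ℕ → K → ℝ} (h : S.IsTower ν G) (k : ℕ) :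
    S.IsTower ν fun i => G (i + k) := by
  obtain ⟨n, hn⟩ := h.fin
  refine ⟨fun i => ?_, n, fun i hi => hn _ (by omega)⟩
  have := h.lap (i + k)
  rwa [Nat.add_right_comm] at this

theorem IsJet.lin {l : Fin 3} {a a' : ℕ → ℝ} {G G' : ℕ → K → ℝ} (h : S.IsJet ν l a G)
    (h' : S.IsJet ν l a' G') (c : ℝ) :
    S.IsJet ν l (fun i => a i + c * a' i) fun i x => G i x + c * G' i x where
  toIsTower := h.toIsTower.lin h'.toIsTower c
  value i := by rw [h.value, h'.value]
  normal i := by simpa using (h.normal i).lin (h'.normal i) c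
  trans i := by simpa using (h.trans i).lin (h'.trans i) c

theorem isJet_zero (l : Fin 3) : S.IsJet ν l (fun _ => 0) fun _ _ => 0 where
  lap _ := hasLaplacian_zero
  fin := ⟨0, fun _ _ => rfl⟩
  value _ := rfl
  normal _ := by simp [HasNormalDeriv]
  trans _ := by simp [HasTransverseDeriv]

theorem IsJet.sum {ι : Type*} (s : Finset ι) {l : Fin 3} {a : ι → ℕ → ℝ} {G : ι → ℕ → K → ℝ}
    (c : ι → ℝ) (h : ∀ p ∈ s, S.IsJet ν l (a p) (G p)) :
    S.IsJet ν l (fun i => ∑ p ∈ s, c p * a p i) fun i x => ∑ p ∈ s, c p * G p i x := by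
  classical
  induction s using Finset.induction_on with
  | empty => simpa using isJet_zero l
  | insert p s hp ih =>
    simp only [Finset.sum_insert hp, add_comm (c p * _)]
    exact (ih fun i hi => h i (Finset.mem_insert_of_mem hi)).lin
      (h p (Finset.mem_insert_self p s)) (c p)

theorem IsJet.shift {l : Fin 3} {a : ℕ → ℝ} {G : ℕ → K → ℝ} (h : S.IsJet ν l a G) (k : ℕ) :
    S.IsJet ν l (fun i => a (i + k)) fun i => G (i + k) where
  toIsTower := h.toIsTower.shift k
  value _ := h.value _
  normal _ := h.normal _
  trans _ := h.trans _

variable [CompactSpace K]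

theorem HasIterLaplacian.unique {f : K → ℝ} : ∀ {i : ℕ} {g g' : K → ℝ},
    S.HasIterLaplacian ν i f g → S.HasIterLaplacian ν i f g' → g = g'
  | 0, _, _, h, h' => h.2.trans h'.2.symm
  | _ + 1, _, _, ⟨_, h1, h2⟩, ⟨_, h1', h2'⟩ => by
    obtain rfl := HasIterLaplacian.unique h1 h1'
    exact h2.unique h2'

/-- The definition provides a separate function for each order i ≤ n. Uniqueness of iterated
Laplacians links them into one sequence, and continuing it by 0 removes the bound n. -/
theorem IsMonomial.exists_isJet {l : Fin 3} {j : ℕ} {f : K → ℝ} (h : S.IsMonomial ν l j 1 f) :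
    ∃ G : ℕ → K → ℝ, G 0 = f ∧ S.IsJet ν l (Pi.single j 1) G := by
  obtain ⟨n, hjn, hn, h⟩ := h
  choose! g hg hgv hgn hgt using h
  have hz : S.IsJet ν l (fun _ => 0) fun _ _ => 0 := isJet_zero l
  refine ⟨fun i => if i ≤ n then g i else fun _ => 0, ?_, ⟨fun i => ?_, n + 1, fun i hi => ?_⟩,
    fun i => ?_, fun i => ?_, fun i => ?_⟩
  · simpa using (hg 0 (Nat.zero_le n)).2
  · rcases lt_trichotomy i n with hi | rfl | hi
    · rw [if_pos hi.le, if_pos (Nat.succ_le_of_lt hi)]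
      obtain ⟨k, hk, hk'⟩ := hg (i + 1) hi
      rwa [(hg i hi.le).unique hk]
    · rw [if_pos le_rfl, if_neg (by omega)]
      obtain ⟨k, hk, hk'⟩ := hn
      rwa [(hg i le_rfl).unique hk]
    · rw [if_neg (by omega), if_neg (by omega)]
      exact hasLaplacian_zero
  · rw [if_neg (by omega)]
  · by_cases hi : i ≤ n
    · rw [if_pos hi, hgv i hi]
      simp [Pi.single_apply]
    · rw [if_neg hi, Pi.single_eq_of_ne (by omega)]
  · by_cases hi : i ≤ n
    · rw [if_pos hi]
      simpa using hgn i hi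
    · rw [if_neg hi]
      exact hz.normal 0
  · by_cases hi : i ≤ n
    · rw [if_pos hi]
      simpa using hgt i hi
    · rw [if_neg hi]
      exact hz.trans 0

variable [BorelSpace K] (hD3 : S.IsD3Symmetric) (hν : S.IsSelfSimilarMeasure ν)
include hD3 hν

theorem IsTower.comp_symmetry {G : ℕ → K → ℝ} (h : S.IsTower ν G) {t : K ≃ₜ K}
    (ht : S.IsSymmetry t) : S.IsTower ν fun i x => G i (t x) := by
  obtain ⟨n, hn⟩ := h.fin
  exact ⟨fun i => (h.lap i).comp_symmetry hD3 hν ht, n, fun i hi => by simp only [hn i hi]⟩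

theorem IsTower.comp_F {ρ : ℝ} (hρ : ∀ l, S.r l * S.mu l = ρ) {G : ℕ → K → ℝ}
    (h : S.IsTower ν G) (l : Fin N) : S.IsTower ν fun i x => ρ ^ i * G i (S.F l x) := by
  obtain ⟨n, hn⟩ := h.fin
  refine ⟨fun i => ?_, n, fun i hi => by simp only [hn i hi, mul_zero]⟩
  simpa only [pow_succ, mul_assoc] using ((h.lap i).comp_F hD3 hν hρ l).smul (ρ ^ i)

theorem isJet_one (l : Fin 3) :
    S.IsJet ν l (Pi.single 0 1) fun i _ => if i = 0 then (1 : ℝ) else 0 where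
  lap i := by
    rcases Nat.eq_zero_or_pos i with rfl | hi
    · simpa using (isHarmonic_const (S := S) 1).hasLaplacian hD3 hν
    · simpa [hi.ne'] using hasLaplacian_zero
  fin := ⟨1, fun i hi => by simp [Nat.one_le_iff_ne_zero.1 hi]⟩
  value i := by simp [Pi.single_apply]
  normal i := by
    rcases Nat.eq_zero_or_pos i with rfl | hi
    · norm_num [HasNormalDeriv]
    · simp [HasNormalDeriv, hi.ne']
  trans i := by simp [HasTransverseDeriv]

variable (hM : ∀ l, (S.M l).det ≠ 0)
include hM

/-- Descending induction from the order where the tower vanishes: if G (i + 1) = 0, then G i is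
harmonic with zero jet. -/
theorem IsJet.eq_zero {l : Fin 3} {G : ℕ → K → ℝ} (h : S.IsJet ν l (fun _ => 0) G) (i : ℕ) :
    G i = fun _ => 0 := by
  obtain ⟨n, hn⟩ := h.fin
  have key : ∀ k i, n ≤ i + k → G i = fun _ => 0 := by
    intro k
    induction k with
    | zero => exact fun i hi => hn i hi
    | succ k ih =>
      intro i hi
      have h1 := h.lap i
      rw [ih (i + 1) (by omega)] at h1
      exact (h1.isHarmonic hD3 hν).eq_zero_of_jet hM hD3 (h.value i) (h.normal i) (h.trans i)
  exact key n i (by omega)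

/-- A multiharmonic function is determined by its jet at a boundary point. -/
theorem IsJet.ext {l : Fin 3} {a : ℕ → ℝ} {G G' : ℕ → K → ℝ} (h : S.IsJet ν l a G)
    (h' : S.IsJet ν l a G') : G = G' := by
  have h1 := h.lin h' (-1)
  have h2 : (fun i => a i + -1 * a i) = fun _ => 0 := funext fun i => by ring
  rw [h2] at h1
  funext i x
  linarith [congrFun (h1.eq_zero hD3 hν hM i) x]

theorem IsJet.comp_symmetry {l k : Fin 3} {a : ℕ → ℝ} {G : ℕ → K → ℝ} (h : S.IsJet ν k a G)
    {t : K ≃ₜ K} (ht : S.IsSymmetry t) (hlk : t (S.q l) = S.q k) :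
    S.IsJet ν l a fun i x => G i (t x) where
  toIsTower := h.toIsTower.comp_symmetry hD3 hν ht
  value i := by rw [hlk, h.value]
  normal i := (h.normal i).comp_symmetry ht hlk
  trans i := (h.trans i).comp_symmetry hM hD3 ht hlk

theorem IsJet.comp_FB {ρ : ℝ} (hρ : ∀ l, S.r l * S.mu l = ρ) {l : Fin 3} {a : ℕ → ℝ}
    {G : ℕ → K → ℝ} (h : S.IsJet ν l a G) :
    S.IsJet ν l (fun i => ρ ^ i * a i) fun i x => ρ ^ i * G i (S.FB l x) where
  toIsTower := h.toIsTower.comp_F hD3 hν hρ _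
  value i := by rw [FB_q, h.value]
  normal i := by
    simpa using (isJet_zero (S := S) (ν := ν) l).normal 0 |>.lin (h.normal i).comp_FB (ρ ^ i)
  trans i := by
    simpa using (isJet_zero (S := S) (ν := ν) l).trans 0 |>.lin
      ((h.trans i).comp_FB hM hD3) (ρ ^ i)

section Monomials

variable {l : Fin 3} {Q : ℕ → K → ℝ} (hQ : ∀ j, S.IsMonomial ν l j 1 (Q j))
include hQ

/-- The shifted tower of Q_j has the jet of Q_{j-i}, or the zero jet when i > j, so uniqueness
identifies Δ^i Q_j. -/
theorem isJet_monomials (j : ℕ) :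
    S.IsJet ν l (Pi.single j 1) fun i x => if i ≤ j then Q (j - i) x else 0 := by
  choose G hG0 hG using fun j => (hQ j).exists_isJet
  have key : G j = fun i x => if i ≤ j then Q (j - i) x else 0 := by
    funext i
    have h1 := (hG j).shift i
    by_cases hi : i ≤ j
    · have h2 : (fun n => (Pi.single j 1 : ℕ → ℝ) (n + i)) = Pi.single (j - i) 1 := by
        funext n
        simp only [Pi.single_apply]
        exact if_congr (by omega) rfl rfl
      rw [h2] at h1
      have h3 := congrFun (h1.ext hD3 hν hM (hG (j - i))) 0
      simp only [zero_add, hG0] at h3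
      simp only [if_pos hi, h3]
    · have h2 : (fun n => (Pi.single j 1 : ℕ → ℝ) (n + i)) = fun _ => 0 := by
        funext n
        exact Pi.single_eq_of_ne (by omega) _
      rw [h2] at h1
      have h3 := h1.eq_zero hD3 hν hM 0
      simp only [zero_add] at h3
      simp only [if_neg hi, h3]
  rw [← key]
  exact hG j

theorem monomial_zero (x : K) : Q 0 x = 1 := by
  have h := congrFun ((isJet_monomials hD3 hν hM hQ 0).ext hD3 hν hM
    (isJet_one hD3 hν l)) 0
  simpa using congrFun h x

theorem monomial_q (j : ℕ) : Q j (S.q l) = (Pi.single j 1 : ℕ → ℝ) 0 := by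
  simpa using (isJet_monomials hD3 hν hM hQ j).value 0

/-- Each Laplacian of a pullback by F_l brings a factor ρ, and the jet of Q_j is concentrated at
order j, so both sides have the same jet. -/
theorem monomial_FB {ρ : ℝ} (hρ : ∀ l, S.r l * S.mu l = ρ) (j : ℕ) (x : K) :
    Q j (S.FB l x) = ρ ^ j * Q j x := by
  have h1 := isJet_monomials hD3 hν hM hQ j
  have h2 := h1.comp_FB hD3 hν hM hρ
  have h3 := (isJet_zero l).lin h1 (ρ ^ j)
  have h4 : (fun i => ρ ^ i * (Pi.single j 1 : ℕ → ℝ) i) =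
      fun i => 0 + ρ ^ j * (Pi.single j 1 : ℕ → ℝ) i := by
    funext i
    rcases eq_or_ne i j with rfl | hi
    · ring
    · simp [hi]
  rw [h4] at h2
  have h5 := congrFun (congrFun (h2.ext hD3 hν hM h3) 0) x
  simpa using h5

theorem monomial_comp_symmetry {k : Fin 3} {Q' : ℕ → K → ℝ}
    (hQ' : ∀ j, S.IsMonomial ν k j 1 (Q' j)) {t : K ≃ₜ K} (ht : S.IsSymmetry t)
    (hlk : t (S.q l) = S.q k) (j : ℕ) (x : K) : Q' j (t x) = Q j x := by
  have h1 := isJet_monomials hD3 hν hM hQ j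
  have h2 := (isJet_monomials hD3 hν hM hQ' j).comp_symmetry hD3 hν hM ht hlk
  have h3 := congrFun (congrFun (h2.ext hD3 hν hM h1) 0) x
  simpa using h3

theorem monomial_q_sub_one (j : ℕ) : Q j (S.q (l - 1)) = Q j (S.q (l + 1)) := by
  obtain ⟨g, hg, hgl, hgm⟩ := exists_reflection hM hD3 l
  have h0 := (hgm 0).1
  simp only [Function.iterate_zero_apply] at h0
  rw [← h0]
  exact monomial_comp_symmetry hD3 hν hM hQ hQ hg hgl j _

theorem hasLaplacian_monomial (j : ℕ) : S.HasLaplacian ν (Q (j + 1)) (Q j) := by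
  simpa using (isJet_monomials hD3 hν hM hQ (j + 1)).lap 0

end Monomials

end HarmonicPCF

end

/-! ### Folding at a junction point and the recursion. -/

noncomputable section

namespace HarmonicPCF

variable {K : Type*} [MetricSpace K] {N : ℕ} {S : HarmonicPCF K N}

open Classical in
variable (S) in
/-- The indicator that `x` is the vertex `F_a q_k` of the pair `p = (a, k)`. -/
def incidence (x : K) (p : Fin N × Fin 3) : ℝ := if S.F p.1 (S.q p.2) = x then 1 else 0

theorem incidence_mul {x : K} {p : Fin N × Fin 3} {s t : ℝ}
    (h : S.F p.1 (S.q p.2) = x → s = t) : S.incidence x p * s = S.incidence x p * t := by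
  unfold incidence
  split_ifs with hx
  · rw [h hx]
  · simp

variable (S) in
theorem vsum_succ_eq_sum (m : ℕ) (φ : (Fin (m + 1) → Fin N) → Fin 3 → ℝ) {x : K}
    (hx : x ∈ S.V 1) : S.vsum (m + 1) φ x =
      ∑ p : Fin N × Fin 3, S.incidence x p * φ (Fin.cons p.1 fun _ => S.corner p.2) p.2 := by
  classical
  rw [vsum_succ_of_mem _ _ _ hx, vsum, sum_words_succ, Fintype.sum_prod_type]
  refine Finset.sum_congr rfl fun l _ => ?_
  simp only [Finset.univ_unique, Finset.sum_singleton, Fin.cons_zero, Fw_cons, Fw_zero,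
    incidence, ite_mul, one_mul, zero_mul]

variable (S) in
theorem mass_succ_eq_sum (m : ℕ) {x : K} (hx : x ∈ S.V 1) : S.mass (m + 1) x =
    ∑ p : Fin N × Fin 3, S.incidence x p * (S.mu p.1 * S.mu (S.corner p.2) ^ m / 3) := by
  rw [mass, vsum_succ_eq_sum _ _ _ hx]
  simp only [muWord_cons]
  simp [muWord]

variable (S) in
theorem mu_lt_one (l : Fin N) : S.mu l < 1 := by
  have : Nontrivial (Fin N) := Fin.nontrivial_iff_two_le.2 (by have := S.three_le; omega)
  obtain ⟨k, hk⟩ := exists_ne l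
  rw [← S.mu_sum]
  exact Finset.single_lt_sum hk (Finset.mem_univ l) (Finset.mem_univ k) (S.mu_pos k)
    fun i _ _ => (S.mu_pos i).le

variable (S) in
theorem tendsto_mass {x : K} (hx : x ∈ S.V 1) :
    Tendsto (fun m => S.mass (m + 1) x) atTop (𝓝 0) := by
  simp only [S.mass_succ_eq_sum _ hx]
  have h : ∀ p ∈ (Finset.univ : Finset (Fin N × Fin 3)), Tendsto
      (fun m => S.incidence x p * (S.mu p.1 * S.mu (S.corner p.2) ^ m / 3)) atTop
      (𝓝 (S.incidence x p * (S.mu p.1 * 0 / 3))) := fun p _ =>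
    (((tendsto_pow_atTop_nhds_zero_of_lt_one (S.mu_pos _).le (S.mu_lt_one _)).const_mul
      _).div_const _).const_mul _
  simpa using tendsto_finsetSum _ h

theorem exists_rotation (hD3 : S.IsD3Symmetric) (l k : Fin 3) :
    ∃ g : K ≃ₜ K, S.IsSymmetry g ∧ ∀ i, g (S.q i) = S.q (i - l + k) := by
  obtain ⟨g, hgq, hg⟩ := hD3 ((Equiv.subRight l).trans (Equiv.addRight k))
  exact ⟨g, hg, hgq⟩

/-- The sum of `f ∘ F_a ∘ g_k`, weighted by conductances, over the `1`-cells `F_a K` with vertex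
`x = F_a q_k`. -/
def localSum (S : HarmonicPCF K N) (g : Fin 3 → K ≃ₜ K) (x : K) (f : K → ℝ) (y : K) : ℝ :=
  ∑ p : Fin N × Fin 3, S.incidence x p * (S.r p.1)⁻¹ * f (S.F p.1 (g p.2 y))

theorem localSum_q {g : Fin 3 → K ≃ₜ K} {l : Fin 3} (hgl : ∀ k, g k (S.q l) = S.q k)
    (x : K) (f : K → ℝ) : S.localSum g x f (S.q l) =
      f x * ∑ p : Fin N × Fin 3, S.incidence x p * (S.r p.1)⁻¹ := by
  rw [localSum, Finset.mul_sum]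
  refine Finset.sum_congr rfl fun p _ => ?_
  rw [mul_assoc, mul_left_comm (f x)]
  refine incidence_mul (S := S) fun h => ?_
  rw [hgl, h, mul_comm]

/-- The maps F_a ∘ g_k carry the m-th corner cell at q_l onto the (m+1)-cells at x. Their
conductances are r_a⁻¹ r^{-m}, because the r of all corners agree by symmetry. -/
theorem graphLaplacian_localSum {g : Fin 3 → K ≃ₜ K} (hg : ∀ k, S.IsSymmetry (g k)) {l : Fin 3}
    (hgl : ∀ k, g k (S.q l) = S.q k) {x : K} (hx : x ∈ S.V 1) (m : ℕ) (f : K → ℝ) :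
    S.graphLaplacian m (S.localSum g x f) (S.q l) = S.graphLaplacian (m + 1) f x := by
  have hlap : lapAt (fun k => S.localSum g x f ((S.FB l)^[m] (S.q k))) l =
      ∑ p : Fin N × Fin 3, S.incidence x p * (S.r p.1)⁻¹ *
        lapAt (fun i => f (S.F p.1 (g p.2 ((S.FB l)^[m] (S.q i))))) l := by
    simp only [lapAt, localSum, Finset.mul_sum, ← Finset.sum_sub_distrib, ← mul_sub]
    rw [Finset.sum_comm]
  rw [graphLaplacian_q, graphLaplacian_eq, vsum_succ_eq_sum _ _ _ hx, hlap, Finset.mul_sum]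
  refine Finset.sum_congr rfl fun p _ => ?_
  rw [(hg p.2).lapAt_corner (hgl p.2) m fun y => f (S.F p.1 y), rWord_cons,
    ← (hg p.2).r_corner (hgl p.2)]
  simp only [Fw_cons, Fw_corner, mul_inv]
  simp only [rWord, Finset.prod_const, Finset.card_univ, Fintype.card_fin]
  ring

variable [MeasurableSpace K] {ν : Measure K} [CompactSpace K] [BorelSpace K]
  (hD3 : S.IsD3Symmetric) (hν : S.IsSelfSimilarMeasure ν)
include hD3 hν

theorem isTower_localSum {ρ : ℝ} (hρ : ∀ l, S.r l * S.mu l = ρ) {g : Fin 3 → K ≃ₜ K}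
    (hg : ∀ k, S.IsSymmetry (g k)) (x : K) {G : ℕ → K → ℝ} (hG : S.IsTower ν G) :
    S.IsTower ν fun i => S.localSum g x fun y => ρ ^ i * G i y :=
  IsTower.sum Finset.univ (fun p : Fin N × Fin 3 => S.incidence x p * (S.r p.1)⁻¹)
    fun p _ => (hG.comp_F hD3 hν hρ p.1).comp_symmetry hD3 hν (hg p.2)

/-- At a junction point the normal derivatives of a function in the domain of the Laplacian add up
to zero. -/
theorem HasLaplacian.hasNormalDeriv_localSum {g : Fin 3 → K ≃ₜ K}
    (hg : ∀ k, S.IsSymmetry (g k)) {l : Fin 3} (hgl : ∀ k, g k (S.q l) = S.q k) {x : K}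
    (hx : x ∈ S.V 1 \ S.V 0) {f f' : K → ℝ} (h : S.HasLaplacian ν f f') :
    S.HasNormalDeriv (S.localSum g x f) l 0 := by
  rw [hasNormalDeriv_iff]
  -- The graph Laplacian at x is a mass tending to 0 times a convergent renormalized Laplacian.
  have h1 := ((S.tendsto_mass hx.1).mul ((tendsto_add_atTop_iff_nat 1).2 (h.tendsto hx))).neg
  rw [zero_mul, neg_zero] at h1
  refine h1.congr fun m => ?_
  rw [graphLaplacian_localSum hg hgl hx.1,
    graphLaplacian_eq_mass_mul hD3 hν (S.V_mono (Nat.le_add_left 1 m) hx.1)]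

variable (hM : ∀ l, (S.M l).det ≠ 0)
include hM

section Monomials

variable {ρ : ℝ} (hρ : ∀ l, S.r l * S.mu l = ρ) {l : Fin 3} {Q : ℕ → K → ℝ}
  (hQ : ∀ j, S.IsMonomial ν l j 1 (Q j))
include hρ hQ

/-- The folded and symmetrized Q_j has the jet of a linear combination of monomials, hence equals
it. The identity is then read off from the graph Laplacian at level 0 at q_l. -/
theorem graphLaplacian_one_monomial (j : ℕ) {x : K} (hx : x ∈ S.V 1 \ S.V 0) :
    S.graphLaplacian 1 (Q j) x = ∑ i ∈ Finset.Icc 1 j,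
      2 * ρ ^ i * (∑ p : Fin N × Fin 3, S.incidence x p * (S.r p.1)⁻¹) *
        Q i (S.q (l + 1)) * Q (j - i) x := by
  set W := ∑ p : Fin N × Fin 3, S.incidence x p * (S.r p.1)⁻¹ with hW
  choose g hg hgq using exists_rotation hD3 l
  have hgl : ∀ k, g k (S.q l) = S.q k := fun k => by rw [hgq, sub_self, zero_add]
  obtain ⟨s, hs, hsl, hsm⟩ := exists_reflection hM hD3 l
  set G : ℕ → K → ℝ := fun i x => if i ≤ j then Q (j - i) x else 0 with hGdef
  have hG := isJet_monomials hD3 hν hM hQ j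
  set H : ℕ → K → ℝ := fun i => S.localSum g x fun y => ρ ^ i * G i y with hH
  have hHt : S.IsTower ν H := isTower_localSum hD3 hν hρ hg x hG.toIsTower
  have hHn : ∀ i, S.HasNormalDeriv (H i) l 0 := fun i =>
    ((hG.lap i).smul (ρ ^ i)).hasNormalDeriv_localSum hD3 hν hg hgl hx
  have hHq : ∀ i, H i (S.q l) = ρ ^ i * G i x * W := fun i => localSum_q hgl x _
  -- Adding the reflected function makes all corner differences 0, so the transverse derivatives
  -- vanish; it doubles the values at q_l.
  have hT : S.IsJet ν l (fun i => 2 * ρ ^ i * G i x * W) fun i y => H i y + 1 * H i (s y) :=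
    { toIsTower := hHt.lin (hHt.comp_symmetry hD3 hν hs) 1
      value := fun i => by
        rw [hsl, hHq]
        ring
      normal := fun i => by simpa using (hHn i).lin ((hHn i).comp_symmetry hs hsl) 1
      trans := fun i => by
        rw [hasTransverseDeriv_iff]
        refine tendsto_const_nhds.congr fun m => ?_
        rw [cornerDiff, (hsm m).1, (hsm m).2]
        ring }
  have hS := IsJet.sum (Finset.range (j + 1)) (fun i => 2 * ρ ^ i * G i x * W)
    fun i _ => isJet_monomials hD3 hν hM hQ i
  have hval : (fun n => ∑ i ∈ Finset.range (j + 1),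
      2 * ρ ^ i * G i x * W * (Pi.single i 1 : ℕ → ℝ) n) = fun n => 2 * ρ ^ n * G n x * W := by
    funext n
    simp only [Pi.single_apply, mul_ite, mul_one, mul_zero, Finset.sum_ite_eq, Finset.mem_range]
    split_ifs with hn
    · rfl
    · rw [hGdef]
      simp [show ¬ n ≤ j by omega]
  rw [hval] at hS
  have hTS := congrFun (hT.ext hD3 hν hM hS) 0
  have h1 : S.graphLaplacian 0 (fun y => H 0 y + 1 * H 0 (s y)) (S.q l) =
      2 * S.graphLaplacian 1 (Q j) x := by
    rw [graphLaplacian_lin, hs.graphLaplacian_comp, hsl]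
    simp only [hH]
    rw [graphLaplacian_localSum hg hgl hx.1]
    simp only [hGdef]
    simp
    ring
  rw [hTS, graphLaplacian_q, lapAt_eq, Fin.sum_univ_three_cyclic _ l] at h1
  have h2 : ∀ i, Q i (S.q l) = (Pi.single i 1 : ℕ → ℝ) 0 := monomial_q hD3 hν hM hQ
  simp only [Function.iterate_zero_apply, pow_zero, inv_one, one_mul, Nat.zero_le, if_true,
    Nat.sub_zero, monomial_q_sub_one hD3 hν hM hQ] at h1
  have h3 : S.graphLaplacian 1 (Q j) x = ∑ i ∈ Finset.range (j + 1),
      2 * ρ ^ i * G i x * W * (Q i (S.q (l + 1)) - Q i (S.q l)) := by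
    simp only [mul_sub, Finset.sum_sub_distrib]
    linarith
  -- The term i = 0 drops out because Q_0 is constant. It is the only term that contains Q_j(x)
  -- itself.
  rw [h3, Finset.range_eq_Ico, Finset.sum_eq_sum_Ico_succ_bot (Nat.succ_pos j),
    monomial_zero hD3 hν hM hQ, monomial_zero hD3 hν hM hQ, sub_self, mul_zero, zero_add]
  refine Finset.sum_congr rfl fun i hi => ?_
  have hi' := Finset.mem_Ico.1 hi
  rw [h2, Pi.single_eq_of_ne (by omega), sub_zero, hGdef]
  simp only [if_pos (Nat.lt_succ_iff.1 hi'.2)]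
  ring

/-- The constant 6 comes from three times the mass of x being ρ times the sum of the r_a⁻¹ over the
1-cells at x. -/
theorem renLaplacian_one_monomial (j : ℕ) {x : K} (hx : x ∈ S.V 1 \ S.V 0) :
    S.renLaplacian ν 1 (Q j) x = ∑ i ∈ Finset.Icc 1 j,
      ρ ^ (i - 1) * 6 * Q i (S.q (l + 1)) * Q (j - i) x := by
  have hmass : 3 * S.mass 1 x =
      ρ * ∑ p : Fin N × Fin 3, S.incidence x p * (S.r p.1)⁻¹ := by
    rw [S.mass_succ_eq_sum 0 hx.1, Finset.mul_sum, Finset.mul_sum]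
    refine Finset.sum_congr rfl fun p _ => ?_
    rw [← hρ p.1]
    have := (S.r_pos p.1).ne'
    field_simp
  rw [renLaplacian_eq hD3 hν hx.1, graphLaplacian_one_monomial hD3 hν hM hρ hQ j hx,
    Finset.mul_sum]
  refine Finset.sum_congr rfl fun i hi => ?_
  obtain ⟨n, rfl⟩ := Nat.exists_eq_add_of_le' (Finset.mem_Icc.1 hi).1
  rw [Nat.add_sub_cancel, inv_mul_eq_iff_eq_mul₀ (S.mass_pos hx.1).ne', pow_succ]
  linear_combination (-2 * ρ ^ n * Q (n + 1) (S.q (l + 1)) * Q (j - (n + 1)) x) * hmass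

/-- Along the points F_l^m x the scaling of Q_1 keeps the renormalized Laplacian constantly equal to
6 α_1, while it must converge uniformly to Q_0 = 1. -/
theorem monomial_one_q_add_one : Q 1 (S.q (l + 1)) = 1 / 6 := by
  have hρ0 : ρ ≠ 0 := hρ (S.corner 0) ▸ (mul_pos (S.r_pos _) (S.mu_pos _)).ne'
  obtain ⟨x, hx⟩ := S.exists_mem_V_one
  have hmem : ∀ m, (S.FB l)^[m] x ∈ S.V (m + 1) \ S.V 0 := by
    intro m
    induction m with
    | zero => exact hx
    | succ m ih =>
      rw [Function.iterate_succ_apply']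
      exact ⟨S.F_mem_V_succ _ ih.1, S.F_notMem_V_zero _ ih.2⟩
  have hconst : ∀ m, S.renLaplacian ν (m + 1) (Q 1) ((S.FB l)^[m] x) =
      6 * Q 1 (S.q (l + 1)) := by
    intro m
    induction m with
    | zero =>
      rw [Function.iterate_zero_apply, renLaplacian_one_monomial hD3 hν hM hρ hQ 1 hx]
      simp [monomial_zero hD3 hν hM hQ]
    | succ m ih =>
      have h1 := renLaplacian_F hD3 hν hρ (m + 1) (Q 1) (S.corner l) (hmem m)
      have h2 : (fun y => Q 1 (S.F (S.corner l) y)) = fun y => 0 + ρ * Q 1 y := funext fun y => by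
        rw [zero_add]
        exact (monomial_FB hD3 hν hM hQ hρ 1 y).trans (by rw [pow_one])
      rw [h2, renLaplacian_lin, ih] at h1
      have h3 : S.renLaplacian ν (m + 1) (fun _ => (0 : ℝ)) ((S.FB l)^[m] x) = 0 := by
        simp [renLaplacian, graphLaplacian]
      rw [h3, zero_add] at h1
      rw [Function.iterate_succ_apply']
      exact mul_left_cancel₀ hρ0 h1
  have h6 : 6 * Q 1 (S.q (l + 1)) = 1 := by
    refine eq_of_forall_dist_le fun ε hε => ?_
    obtain ⟨m₀, hm⟩ := (hasLaplacian_monomial hD3 hν hM hQ 0).2.2 ε hε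
    have h := hm (m₀ + 1) (Nat.le_succ _) _ (hmem m₀)
    rw [hconst, monomial_zero hD3 hν hM hQ] at h
    exact h.le
  linarith

end Monomials

omit hM in
/-- The homogeneous system behind the recursion has only the trivial solution. -/
theorem eqOn_zero_of_homogeneous_system {ρ : ℝ} (hρ : ∀ l, S.r l * S.mu l = ρ) {l : Fin 3}
    {j : ℕ} (hj : 2 ≤ j) {d : K → ℝ}
    (h1 : ∀ x ∈ S.V 1 \ S.V 0, S.renLaplacian ν 1 d x = ρ ^ (j - 1) * 6 * d (S.q (l + 1)))
    (h2 : ∀ i, d (S.FB l (S.q i)) = ρ ^ j * d (S.q i))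
    (h3 : d (S.q (l - 1)) = d (S.q (l + 1))) : EqOn d (fun _ => 0) (S.V 1) := by
  have hρ0 : 0 < ρ := hρ (S.corner 0) ▸ mul_pos (S.r_pos _) (S.mu_pos _)
  have hρ1 : ρ < 1 := by
    rw [← hρ (S.corner 0)]
    exact mul_lt_one_of_nonneg_of_lt_one_left (S.r_pos _).le (S.r_lt_one _) (S.mu_lt_one _).le
  have hq : d (S.q l) = 0 := by
    have h4 := h2 l
    rw [FB_q] at h4
    have h5 : ρ ^ j < 1 := pow_lt_one₀ hρ0.le hρ1 (by omega)
    nlinarith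
  set c := d (S.q (l + 1)) with hc
  set h := S.harmonicExt (Pi.single l 1) with hh
  have hharm : S.IsHarmonic h := S.isHarmonic_harmonicExt _
  have hhq : ∀ i, h (S.q i) = (Pi.single l 1 : Fin 3 → ℝ) i := S.harmonicExt_q _
  obtain ⟨n, rfl⟩ := Nat.exists_eq_add_of_le' hj
  -- Since d(F_l q) = ρ^j d(q) and d(q_l) = 0, the Laplacian at q_l is 2 r⁻¹ρ^j c = 2 μ_l ρ^{j-1} c,
  -- and the mass there is μ_l / 3. The equation thus also holds at q_l.
  have hlapl : S.graphLaplacian 1 d (S.q l) = S.mass 1 (S.q l) * (ρ ^ (n + 1) * 6 * c) := by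
    rw [graphLaplacian_q, lapAt_eq, Fin.sum_univ_three_cyclic _ l, mass_q]
    simp only [Function.iterate_one, h2, h3, hq, ← hc, pow_one]
    have h6 : ρ ^ (n + 2) = S.r (S.corner l) * S.mu (S.corner l) * ρ ^ (n + 1) := by
      rw [hρ]
      ring
    have := (S.r_pos (S.corner l)).ne'
    rw [h6]
    field_simp
    ring
  have hgreen : ∀ x ∈ S.vertices 1, h x * S.graphLaplacian 1 d x =
      ρ ^ (n + 1) * 6 * c * (h x * S.mass 1 x) := by
    intro x hx
    rw [mem_vertices] at hx
    by_cases hx0 : x ∈ S.V 0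
    · obtain ⟨i, rfl⟩ := S.mem_V_zero.1 hx0
      rcases eq_or_ne i l with rfl | hi
      · rw [hlapl]
        ring
      · rw [hhq, Pi.single_eq_of_ne hi]
        ring
    · rw [graphLaplacian_eq_mass_mul hD3 hν hx, h1 x ⟨hx, hx0⟩]
      simp only [show n + 2 - 1 = n + 1 by omega]
      ring
  -- This is the mean of the boundary values 1, 0, 0 of h.
  have hsum : ∑ x ∈ S.vertices 1, h x * S.mass 1 x = 1 / 3 := by
    have h7 := hharm.sum_muWord hD3 1
    rw [Fin.sum_univ_three_cyclic _ l, hhq, hhq, hhq, Pi.single_eq_same,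
      Pi.single_eq_of_ne (Fin.add_one_ne_self_three l),
      Pi.single_eq_of_ne (Fin.sub_one_ne_self_three l)] at h7
    have h8 := S.sum_vsum 1 h fun w _ => S.muWord w / 3
    refine h8.trans ?_
    simp only [← Finset.sum_mul]
    calc ∑ w : Fin 1 → Fin N, (∑ i, h (S.Fw w (S.q i))) * (S.muWord w / 3)
        = (∑ w : Fin 1 → Fin N, S.muWord w * ∑ i, h (S.Fw w (S.q i))) / 3 := by
          rw [Finset.sum_div]
          exact Finset.sum_congr rfl fun w _ => by ring
      _ = 1 / 3 := by
          rw [h7]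
          norm_num
  have hform := hharm.form_eq d 1
  rw [form_comm, form_eq_neg_sum, Finset.sum_congr rfl hgreen, ← Finset.mul_sum, hsum,
    form_comm, form_zero, form0_comm, form0_comm, form0_eq_neg_sum_lapAt,
    Fin.sum_univ_three_cyclic _ l] at hform
  simp only [hhq, lapAt_eq, Fin.sum_univ_three_cyclic _ l] at hform
  simp only [Pi.single_eq_same, Pi.single_eq_of_ne (Fin.add_one_ne_self_three l),
    Pi.single_eq_of_ne (Fin.sub_one_ne_self_three l), hq, h3, ← hc] at hform
  -- Green's formula reads 2c = 2ρ^{j-1}c. For j = 1 it is vacuous, which is why the boundary values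
  -- of the first function of the recursion must be prescribed.
  have hc0 : c = 0 := by
    have h9 : ρ ^ (n + 1) < 1 := pow_lt_one₀ hρ0.le hρ1 (by omega)
    have h10 : c * (1 - ρ ^ (n + 1)) = 0 := by linarith
    exact (mul_eq_zero.1 h10).resolve_right (by linarith)
  refine eqOn_V_of_renLaplacian_eq hD3 hν (fun i => ?_) fun x hx => ?_
  · rcases Fin.eq_or_three l i with h | h | h
    · rw [h, hq]
    · rw [h, ← hc, hc0]
    · rw [h, h3, hc0]
  · rw [h1 x hx, hc0]
    simp [renLaplacian, graphLaplacian]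

end HarmonicPCF

end

/-! ### Assembly of the theorem. -/

theorem theorem7p2 {K : Type*} [MetricSpace K] [CompactSpace K] [MeasurableSpace K] [BorelSpace K]
    {N : ℕ} (S : HarmonicPCF K N) (hD3 : S.IsD3Symmetric) (hM : ∀ l, (S.M l).det ≠ 0)
    (ρ : ℝ) (hρ : ∀ l, S.r l * S.mu l = ρ)
    (ν : Measure K) (hν : S.IsSelfSimilarMeasure ν)
    (Q : Fin 3 → ℕ → K → ℝ) (hQ : ∀ l j, S.IsMonomial ν l j 1 (Q l j))
    (α : ℕ → ℝ) (hα : ∀ j, α j = Q 0 j (S.q 1)) (l : Fin 3) :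
    -- the numbers `α j` are the boundary values of the monomials at `q_l`, for every `l`
    (∀ j, Q l j (S.q (l + 1)) = α j ∧ Q l j (S.q (l - 1)) = α j) ∧
    -- the relations, and the unique determination
    (∀ j, 2 ≤ j →
      (∀ x ∈ S.V 1 \ S.V 0, S.renLaplacian ν 1 (Q l j) x =
        ∑ i ∈ Finset.Icc 1 j, ρ ^ (i - 1) * (α 1)⁻¹ * α i * Q l (j - i) x) ∧
      (∀ i, Q l j (S.FB l (S.q i)) = ρ ^ j * Q l j (S.q i)) ∧
      (∀ f : K → ℝ, S.IsRecursionSolution ν ρ l j (Q l) f ↔ EqOn f (Q l j) (S.V 1))) ∧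
    -- the recursive algorithm: initial data, and the outcome of solving the systems one by one
    (α 0 = 1 ∧ α 1 = 1 / 6) ∧
    (∀ f : ℕ → K → ℝ,
      (∀ x ∈ S.V 1, f 0 x = 1) →
      (∀ x ∈ S.V 1 \ S.V 0, S.renLaplacian ν 1 (f 1) x = 1) →
      f 1 (S.q l) = 0 → f 1 (S.q (l + 1)) = 1 / 6 → f 1 (S.q (l - 1)) = 1 / 6 →
      (∀ j, 2 ≤ j → S.IsRecursionSolution ν ρ l j f (f j)) →
      ∀ j, EqOn (f j) (Q l j) (S.V 1) ∧ f j (S.q (l + 1)) = α j) := by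
  have hαl : ∀ j, Q l j (S.q (l + 1)) = α j := by
    intro j
    obtain ⟨g, hg, hgq⟩ := HarmonicPCF.exists_rotation hD3 l 0
    rw [hα, ← HarmonicPCF.monomial_comp_symmetry hD3 hν hM (hQ l) (hQ 0) hg
      (by rw [hgq, sub_self, zero_add]), hgq]
    simp
  have hα1 : α 1 = 1 / 6 := by
    rw [← hαl]
    exact HarmonicPCF.monomial_one_q_add_one hD3 hν hM hρ (hQ l)
  have hα1' : (α 1)⁻¹ = 6 := by
    rw [hα1]
    norm_num
  have hQ0 : ∀ x, Q l 0 x = 1 := HarmonicPCF.monomial_zero hD3 hν hM (hQ l)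
  have hQl : ∀ j, Q l j (S.q (l - 1)) = α j := fun j =>
    (HarmonicPCF.monomial_q_sub_one hD3 hν hM (hQ l) j).trans (hαl j)
  have hrel : ∀ j, ∀ x ∈ S.V 1 \ S.V 0, S.renLaplacian ν 1 (Q l j) x =
      ∑ i ∈ Finset.Icc 1 j, ρ ^ (i - 1) * (α 1)⁻¹ * α i * Q l (j - i) x := by
    intro j x hx
    rw [HarmonicPCF.renLaplacian_one_monomial hD3 hν hM hρ (hQ l) j hx]
    simp only [hαl, hα1']
  have hFB : ∀ j i, Q l j (S.FB l (S.q i)) = ρ ^ j * Q l j (S.q i) := fun j i =>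
    HarmonicPCF.monomial_FB hD3 hν hM (hQ l) hρ j _
  -- The term i = j is split off: it carries the coefficient α_j, which is the unknown of the
  -- system.
  have hlast : ∀ j, 2 ≤ j → ∀ x, ∑ i ∈ Finset.Icc 1 j,
      ρ ^ (i - 1) * (α 1)⁻¹ * α i * Q l (j - i) x =
      (∑ i ∈ Finset.Ico 1 j, ρ ^ (i - 1) * (α 1)⁻¹ * α i * Q l (j - i) x) +
        ρ ^ (j - 1) * (α 1)⁻¹ * α j * Q l 0 x := by
    intro j hj x
    rw [← Finset.Ico_insert_right (show 1 ≤ j by omega),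
      Finset.sum_insert Finset.right_notMem_Ico, Nat.sub_self, add_comm]
  have huniq : ∀ j, 2 ≤ j → ∀ f : K → ℝ,
      S.IsRecursionSolution ν ρ l j (Q l) f ↔ EqOn f (Q l j) (S.V 1) := by
    intro j hj f
    unfold HarmonicPCF.IsRecursionSolution
    simp only [hαl]
    constructor
    · rintro ⟨h1, h2, h3⟩
      -- In the difference of f and Q_j the known terms cancel, leaving the homogeneous system.
      have h0 := HarmonicPCF.eqOn_zero_of_homogeneous_system hD3 hν hρ (l := l) hj
        (d := fun x => f x + -1 * Q l j x) (fun x hx => by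
          rw [HarmonicPCF.renLaplacian_lin, h1 x hx, hrel j x hx, hlast j hj, hα1', hQ0, hαl]
          ring) (fun i => by
          rw [h2, hFB]
          ring) (by rw [h3, hQl, hαl])
      intro x hx
      have := h0 hx
      simp only at this
      linarith
    · intro hf
      refine ⟨fun x hx => ?_, fun i => ?_, ?_⟩
      · rw [HarmonicPCF.renLaplacian, S.graphLaplacian_congr hf, ← HarmonicPCF.renLaplacian,
          hrel j x hx, hlast j hj, hf (S.q_mem_V 1 _), hαl]
      · have hi : S.FB l (S.q i) ∈ S.V 1 := S.FB_iterate_mem_V 1 l i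
        rw [hf hi, hf (S.q_mem_V 1 i), hFB]
      · rw [hf (S.q_mem_V 1 _), hf (S.q_mem_V 1 _), hQl, hαl]
  refine ⟨fun j => ⟨hαl j, hQl j⟩, fun j hj => ⟨hrel j, hFB j, huniq j hj⟩,
    ⟨by rw [← hαl, hQ0], hα1⟩, ?_⟩
  intro f hf0 hf1 hf1l hf1p hf1m hf j
  suffices h : EqOn (f j) (Q l j) (S.V 1) from ⟨h, by rw [h (S.q_mem_V 1 _), hαl]⟩
  induction j using Nat.strong_induction_on with
  | _ j ih =>
    rcases lt_or_ge j 2 with hj | hj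
    · interval_cases j
      · exact fun x hx => (hf0 x hx).trans (hQ0 x).symm
      -- For j = 1 all three boundary values are given, so this is a Dirichlet problem on V_1.
      · refine HarmonicPCF.eqOn_V_of_renLaplacian_eq hD3 hν (fun i => ?_) fun x hx => ?_
        · rcases Fin.eq_or_three l i with h | h | h
          · rw [h, hf1l, HarmonicPCF.monomial_q hD3 hν hM (hQ l)]
            simp
          · rw [h, hf1p, hαl, hα1]
          · rw [h, hf1m, hQl, hα1]
        · rw [hf1 x hx, hrel 1 x hx]
          simp [hα1, hQ0]
    · refine (huniq j hj (f j)).1 ?_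
      obtain ⟨h1, h2, h3⟩ := hf j hj
      refine ⟨fun x hx => ?_, h2, h3⟩
      rw [h1 x hx, ih 1 (by omega) (S.q_mem_V 1 _), ih 0 (by omega) hx.1]
      congr 1
      refine Finset.sum_congr rfl fun i hi => ?_
      have hi' := Finset.mem_Ico.1 hi
      rw [ih i hi'.2 (S.q_mem_V 1 _), ih (j - i) (by omega) hx.1]
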